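/- Let $G$ be a nilpotent group generated by a $k$-tuple $S=(s_1,\dots,s_k)$ of elements (repetitions allowed), and let $a=(\alpha_1,\dots,\alpha_k)\in(0,\infty]^k$. Let $\mu_{S,a}$ be the symmetric probability measure $$\mu_{S,a}(g)=\frac1k\sum_{i=1}^k c(\alpha_i)\sum_{m\in\mathbb Z}(1+|m|)^{-\alpha_i-1}\mathbf 1_{\{s_i^m\}}(g),\qquad c(\alpha)^{-1}=\sum_{m\in\mathbb Z}(1+|m|)^{-\alpha-1},$$ where, when $\alpha=\infty$, $(1+|m|)^{-\alpha-1}$ is understood to be $1$ if $m\in\{-1,0,1\}$ and $0$ otherwise. Let $\mu_{S,a}^{(n)}$ be its $n$-fold convolution power and $e$ the identity of $G$. Let $G_1=G$, $G_{j+1}=[G,G_j]$ be the lower central series, and put $D(G)=\sum_{j\ge1} j\,\mathrm{rank}(G_j/G_{j+1})$, where $\mathrm{rank}$ is the torsion free rank of a finitely generated abelian group. For $g\in G$, the commutator length $\ell(g)\in\{1,2,\dots\}\cup\{\infty\}$ is the supremum of the integers $j\ge1$ such that $g^m\in G_j$ for some nonzero integer $m$ (so $\ell(g)=\infty$ if $g$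 has finite order). Assume that there is an $i\in\{1,\dots,k\}$ such that $(\alpha_i,\ell(s_i))=(2,1)$ or $\alpha_i\,\ell(s_i)<2$. Then $$\lim_{n\to\infty} n^{D(G)/2}\,\mu_{S,a}^{(n)}(e)=0 .$$ Moreover, the probability of return of this walk decays strictly faster than that of simple random walk on $G$: for every finite symmetric generating set $A$ of $G$, with $u_A$ the uniform probability measure on $A$, $$\lim_{n\to\infty}\frac{\mu_{S,a}^{(2n)}(e)}{u_A^{(2n)}(e)}=0 .$$ -/

import Mathlib

open Filter Topology Asymptotics
open scoped ENNReal

noncomputable section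

namespace NilpotentWalk

section Algebra

variable (G : Type*) [Group G]

/-- The factor `G_{j+1} / G_{j+2}` of the lower central series, in the indexing `G_1 = G`,
`G_{j+1} = [G, G_j]`.  Mathlib's `lowerCentralSeries ⊤ j` is `G_{j+1}`. -/
abbrev LCSFactor (j : ℕ) : Type _ :=
  (Subgroup.lowerCentralSeries (⊤ : Subgroup G) j) ⧸
    (Subgroup.lowerCentralSeries (⊤ : Subgroup G) (j + 1)).subgroupOf (Subgroup.lowerCentralSeries (⊤ : Subgroup G) j)

open scoped commutatorElement in
instance lcsFactorCommGroup (j : ℕ) : CommGroup (LCSFactor G j) :=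
  { (inferInstance : Group (LCSFactor G j)) with
    mul_comm := by
      intro x y
      induction x using QuotientGroup.induction_on with
      | H a =>
        induction y using QuotientGroup.induction_on with
        | H b =>
          rw [← QuotientGroup.mk_mul, ← QuotientGroup.mk_mul, QuotientGroup.eq]
          rw [Subgroup.mem_subgroupOf]
          have h : ⁅((b : G))⁻¹, ((a : G))⁻¹⁆ ∈ Subgroup.lowerCentralSeries (⊤ : Subgroup G) (j + 1) :=
            Subgroup.commutator_mem_commutator (inv_mem b.2) (Subgroup.mem_top _)
          simpa [commutatorElement_def, mul_assoc] using h }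

/-- Torsion free rank of the abelian group `G_{j+1} / G_{j+2}`: the maximal number of
`ℤ`-linearly independent elements. -/
def lcsRank (j : ℕ) : ℕ := Module.finrank ℤ (Additive (LCSFactor G j))

/-- `D(G) = ∑_{j ≥ 1} j * rank (G_j / G_{j+1})`; the terms with `j` larger than the nilpotency
class vanish. -/
def homogeneousDim [Group.IsNilpotent G] : ℕ :=
  ∑ j ∈ Finset.range (Group.nilpotencyClass G), (j + 1) * lcsRank G j

variable {G}

/-- Commutator length of `g`: the supremum of the integers `j ≥ 1` such that `g ^ m ∈ G_j` for
some nonzero integer `m` (so it is `⊤` on torsion elements of a group). -/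
def commLength (g : G) : ℕ∞ :=
  ⨆ (j : ℕ) (_ : ∃ m : ℤ, m ≠ 0 ∧ g ^ m ∈ Subgroup.lowerCentralSeries (⊤ : Subgroup G) j), ((j + 1 : ℕ) : ℕ∞)

end Algebra

section Walk

/-- The power law weight `(1 + |m|) ^ (-α - 1)`; for `α = ∞` it is the indicator of
`m ∈ {-1, 0, 1}`. -/
def powerWeight (α : ℝ≥0∞) (m : ℤ) : ℝ :=
  if α = ∞ then (if |m| ≤ 1 then 1 else 0) else (1 + |(m : ℝ)|) ^ (-α.toReal - 1)

/-- The normalizing constant `c(α)`. -/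
def powerNorm (α : ℝ≥0∞) : ℝ := (∑' m : ℤ, powerWeight α m)⁻¹

variable {G : Type*} [Group G]

open Classical in
/-- The measure `μ_{S,a}`, given by its mass function. -/
def stepMeasure {k : ℕ} (s : Fin k → G) (a : Fin k → ℝ≥0∞) (g : G) : ℝ :=
  (1 / (k : ℝ)) * ∑ i, powerNorm (a i) *
    ∑' m : ℤ, powerWeight (a i) m * (if s i ^ m = g then 1 else 0)

open Classical in
/-- The uniform probability measure `u_A` on a finite set `A`, given by its mass function. -/
def uniformMeasure (A : Finset G) (g : G) : ℝ :=
  if g ∈ A then 1 / (A.card : ℝ) else 0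

/-- Convolution of (the mass functions of) two measures on a discrete group. -/
def conv (μ ν : G → ℝ) (g : G) : ℝ := ∑' h : G, μ h * ν (h⁻¹ * g)

open Classical in
/-- Convolution powers `μ^{(n)}`, with `μ^{(0)}` the unit mass at the identity. -/
def convPow (μ : G → ℝ) : ℕ → G → ℝ
  | 0 => fun g => if g = 1 then 1 else 0
  | n + 1 => conv (convPow μ n) μ

end Walk

end NilpotentWalk

end

/-!
The theorem compares two bounds, and both come from the scaling structure of the lower central
series, in which an element of `G_j` raised to the power `r ^ j` has size of order `r`.

*Upper bound for `μ = μ_{S,a}`.*  Since `μ^{(2n)}` is positive definite, the function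
`N x = (2 (μ^{(2n)}(e) - μ^{(2n)}(x)))^{1/2}` is the `ℓ²` distance between `μ^{(n)}` and a translate
of it, hence subadditive (`IsSymmProb.exists_translation_dist`).  Put
`E = μ^{(2n)}(e) - μ^{(2n+2)}(e)`.  As `μ(e) > 0`, this quantity controls the Dirichlet form
`∑ μ(h) N(h) ^ 2` (`IsSymmProb.sum_le_sub`), so `N = O(√E)` on the generators.  Representing powers
`g ^ m`, `g ∈ G_j`, `m ≤ r ^ j`, by words of length `O(r)` modulo `G_{j+1}`
(`IsGenerating.exists_short_representative`) gives a box of `r ^ D(G)` elements with `N = O(r √E)`.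
The distinguished generator does better: its weights are so heavy that the powers of exponent at
most `K r ^ ℓ` also satisfy `N = O(r √E)`, with a constant that does not depend on `K`, once `r` is
large (`exists_forall_sq_le`); for `(α, ℓ) = (2, 1)` this is a logarithmic gain, summed over the
scales `m / 3 ^ i`.  As a suitable power of that generator is part of a maximal independent family in
`G_ℓ / G_{ℓ+1}`, the box grows by the factor `K` (`IsGenerating.exists_box_of_not_mem`).  Averaging
`μ^{(2n)}` over the box yields the Nash inequality `u_n ≤ C r ^ 2 (u_n - u_{n+1}) + 1 / (K r ^ D)` for
`u_n = μ^{(2n)}(e)`.  Since `K` is arbitrary and `C` is fixed, `u_n = o(n ^ (-D / 2))`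
(`tendsto_sqrt_pow_mul_of_nash`).

*Lower bound for simple random walk.*  The volume of balls is `O(r ^ D(G))` (`exists_card_pow_le`).
To see this, letters of weight `j` are given the cost `r ^ (-j)`.  Conjugation by a letter of weight
`j` distorts costs by a factor `1 + O(r ^ (-j))` only, because commutators add weights; so letters can
be collected to the left, in the order of their weights, at a bounded cost, and only a family that is
independent modulo the next term contributes unbounded exponents.  The tent function on a ball of
radius of order `√n` then has Rayleigh quotient `1 - O(1 / n)`, which forces
`u_A^{(2n)}(e) ≥ c n ^ (-D / 2)` (`IsSymmProb.exists_pos_le_convPow`).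
-/

namespace NilpotentWalk

open scoped commutatorElement Pointwise

/-! ### Commutators and the lower central series -/

section LowerCentralSeries

variable {G : Type*} [Group G]

theorem zpow_commutatorElement_of_mem_center {a y : G} (h : ⁅a, y⁆ ∈ Subgroup.center G) (n : ℤ) :
    ⁅a ^ n, y⁆ = ⁅a, y⁆ ^ n := by
  have h1 : y * a * y⁻¹ = ⁅a, y⁆⁻¹ * a := by
    rw [commutatorElement_def]; group
  have hc : Commute (⁅a, y⁆⁻¹) a :=
    ((Subgroup.mem_center_iff.mp (inv_mem h)) a).symm
  have h2 : y * a ^ n * y⁻¹ = (⁅a, y⁆⁻¹) ^ n * a ^ n := by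
    rw [← conj_zpow, h1, hc.mul_zpow]
  have h3 : ⁅a ^ n, y⁆ = a ^ n * (y * a ^ n * y⁻¹)⁻¹ := by
    rw [commutatorElement_def]; group
  rw [h3, h2, mul_inv_rev, inv_zpow, inv_inv, mul_inv_cancel_left]

theorem commutatorElement_zpow_of_mem_center {a y : G} (h : ⁅a, y⁆ ∈ Subgroup.center G) (n : ℤ) :
    ⁅a, y ^ n⁆ = ⁅a, y⁆ ^ n := by
  have h' : ⁅y, a⁆ ∈ Subgroup.center G := by
    rw [← commutatorElement_inv]; exact inv_mem h
  rw [← commutatorElement_inv, zpow_commutatorElement_of_mem_center h', ← inv_zpow,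
    commutatorElement_inv]

/-- The three subgroups lemma modulo a normal subgroup. -/
theorem commutator_commutator_le_of_rotate {H₁ H₂ H₃ N : Subgroup G} [N.Normal]
    (h1 : ⁅⁅H₂, H₃⁆, H₁⁆ ≤ N) (h2 : ⁅⁅H₃, H₁⁆, H₂⁆ ≤ N) : ⁅⁅H₁, H₂⁆, H₃⁆ ≤ N := by
  have key : ∀ K : Subgroup G, K ≤ N ↔ K.map (QuotientGroup.mk' N) = ⊥ := by
    intro K
    rw [Subgroup.map_eq_bot_iff, QuotientGroup.ker_mk']
  rw [key, Subgroup.map_commutator, Subgroup.map_commutator] at *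
  exact Subgroup.commutator_commutator_eq_bot_of_rotate h1 h2

/-- `[G_i, G_j] ≤ G_{i+j}`, in the indexing of Mathlib. -/
theorem commutator_lowerCentralSeries_le (i j : ℕ) :
    ⁅Subgroup.lowerCentralSeries (⊤ : Subgroup G) i,
      Subgroup.lowerCentralSeries (⊤ : Subgroup G) j⁆ ≤
      Subgroup.lowerCentralSeries (⊤ : Subgroup G) (i + j + 1) := by
  induction j generalizing i with
  | zero => exact le_rfl
  | succ j ih =>
    rw [Subgroup.commutator_comm, Subgroup.lowerCentralSeries_succ _ j]
    apply commutator_commutator_le_of_rotate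
    · rw [Subgroup.commutator_comm ⊤, ← Subgroup.lowerCentralSeries_succ]
      refine (ih (i + 1)).trans (le_of_eq ?_)
      congr 1; ring
    · refine (Subgroup.commutator_mono (ih i) le_rfl).trans ?_
      rw [← Subgroup.lowerCentralSeries_succ]
      exact le_of_eq (by congr 1)

theorem commutatorElement_mem_lowerCentralSeries {i j : ℕ} {x y : G}
    (hx : x ∈ Subgroup.lowerCentralSeries (⊤ : Subgroup G) i)
    (hy : y ∈ Subgroup.lowerCentralSeries (⊤ : Subgroup G) j) :
    ⁅x, y⁆ ∈ Subgroup.lowerCentralSeries (⊤ : Subgroup G) (i + j + 1) :=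
  commutator_lowerCentralSeries_le i j (Subgroup.commutator_mem_commutator hx hy)

theorem mk_mem_center_of_mem_lowerCentralSeries {j : ℕ} {x : G}
    (hx : x ∈ Subgroup.lowerCentralSeries (⊤ : Subgroup G) j) :
    (x : G ⧸ Subgroup.lowerCentralSeries (⊤ : Subgroup G) (j + 1)) ∈ Subgroup.center _ := by
  rw [Subgroup.mem_center_iff]
  intro g
  induction g using QuotientGroup.induction_on with
  | H g =>
    rw [← QuotientGroup.mk_mul, ← QuotientGroup.mk_mul, QuotientGroup.eq]
    have h : ⁅x⁻¹, g⁻¹⁆ ∈ Subgroup.lowerCentralSeries (⊤ : Subgroup G) (j + 1) :=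
      commutatorElement_mem_lowerCentralSeries (j := 0) (inv_mem hx) (Subgroup.mem_top _)
    simpa [commutatorElement_def, mul_assoc] using h

theorem conj_mem_iff_of_lowerCentralSeries_le {j : ℕ} {K : Subgroup G}
    (hK : Subgroup.lowerCentralSeries (⊤ : Subgroup G) (j + 1) ≤ K) {z : G}
    (hz : z ∈ Subgroup.lowerCentralSeries (⊤ : Subgroup G) j) (y : G) :
    y * z * y⁻¹ ∈ K ↔ z ∈ K := by
  have h : ⁅z, y⁆⁻¹ ∈ K := inv_mem (hK
    (commutatorElement_mem_lowerCentralSeries (j := 0) hz (Subgroup.mem_top _)))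
  have e : y * z * y⁻¹ = ⁅z, y⁆⁻¹ * z := by rw [commutatorElement_def]; group
  rw [e, Subgroup.mul_mem_cancel_left _ h]

/-- If `L` generates `G_j` modulo `G_{j+1}` and `S` generates `G`, then the commutators `[x, s]`
generate `G_{j+1}` modulo `G_{j+2}`. -/
theorem lowerCentralSeries_succ_le_closure_sup {S L : Set G} {j : ℕ}
    (hS : Subgroup.closure S = ⊤)
    (hLj : L ⊆ Subgroup.lowerCentralSeries (⊤ : Subgroup G) j)
    (hL : Subgroup.lowerCentralSeries (⊤ : Subgroup G) j ≤
      Subgroup.closure L ⊔ Subgroup.lowerCentralSeries (⊤ : Subgroup G) (j + 1)) :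
    Subgroup.lowerCentralSeries (⊤ : Subgroup G) (j + 1) ≤
      Subgroup.closure (Set.image2 (fun x s => ⁅x, s⁆) L S) ⊔
        Subgroup.lowerCentralSeries (⊤ : Subgroup G) (j + 2) := by
  set K := Subgroup.closure (Set.image2 (fun x s => ⁅x, s⁆) L S) ⊔
        Subgroup.lowerCentralSeries (⊤ : Subgroup G) (j + 2) with hKdef
  have hK : Subgroup.lowerCentralSeries (⊤ : Subgroup G) (j + 2) ≤ K := le_sup_right
  have hcomm : ∀ x ∈ Subgroup.lowerCentralSeries (⊤ : Subgroup G) j, ∀ y : G,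
      ⁅x, y⁆ ∈ Subgroup.lowerCentralSeries (⊤ : Subgroup G) (j + 1) := fun x hx y =>
    commutatorElement_mem_lowerCentralSeries (j := 0) hx (Subgroup.mem_top _)
  have step1 : ∀ x ∈ L, ∀ y : G, ⁅x, y⁆ ∈ K := by
    intro x hx y
    have hy : y ∈ Subgroup.closure S := hS ▸ Subgroup.mem_top y
    induction hy using Subgroup.closure_induction with
    | mem y hy =>
      exact (le_sup_left : _ ≤ K) (Subgroup.subset_closure (Set.mem_image2_of_mem hx hy))
    | one => simp
    | mul y z _ _ h1 h2 =>
      have e : ⁅x, y * z⁆ = ⁅x, y⁆ * (y * ⁅x, z⁆ * y⁻¹) := by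
        simp only [commutatorElement_def]; group
      rw [e]
      exact mul_mem h1 ((conj_mem_iff_of_lowerCentralSeries_le hK (hcomm x (hLj hx) z) y).2 h2)
    | inv y _ h1 =>
      have e : ⁅x, y⁻¹⁆ = y⁻¹ * ⁅x, y⁆⁻¹ * y⁻¹⁻¹ := by
        simp only [commutatorElement_def]; group
      rw [e]
      exact (conj_mem_iff_of_lowerCentralSeries_le hK
        (inv_mem (hcomm x (hLj hx) y)) y⁻¹).2 (inv_mem h1)
  have step2 : ∀ x ∈ Subgroup.lowerCentralSeries (⊤ : Subgroup G) j, ∀ y : G, ⁅x, y⁆ ∈ K := by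
    intro x hx y
    have hle : Subgroup.closure L ⊔ Subgroup.lowerCentralSeries (⊤ : Subgroup G) (j + 1) ≤
        Subgroup.lowerCentralSeries (⊤ : Subgroup G) j :=
      sup_le ((Subgroup.closure_le _).2 hLj) (Subgroup.lowerCentralSeries_antitone _ (Nat.le_succ j))
    have hx' := hL hx
    rw [← Subgroup.closure_eq (Subgroup.lowerCentralSeries (⊤ : Subgroup G) (j + 1)),
      ← Subgroup.closure_union] at hx' hle
    induction hx' using Subgroup.closure_induction with
    | mem x hx' =>
      rcases hx' with h | h
      · exact step1 x h y
      · exact hK (commutatorElement_mem_lowerCentralSeries (j := 0) h (Subgroup.mem_top _))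
    | one => simp
    | mul a b ha hb h1 h2 =>
      have e : ⁅a * b, y⁆ = a * ⁅b, y⁆ * a⁻¹ * ⁅a, y⁆ := by
        simp only [commutatorElement_def]; group
      rw [e]
      exact mul_mem ((conj_mem_iff_of_lowerCentralSeries_le hK (hcomm b (hle hb) y) a).2
        (h2 (hle hb))) (h1 (hle ha))
    | inv a ha h1 =>
      have e : ⁅a⁻¹, y⁆ = a⁻¹ * ⁅a, y⁆⁻¹ * a⁻¹⁻¹ := by
        simp only [commutatorElement_def]; group
      rw [e]
      exact (conj_mem_iff_of_lowerCentralSeries_le hK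
        (inv_mem (hcomm a (hle ha) y)) a⁻¹).2 (inv_mem (h1 (hle ha)))
  rw [Subgroup.lowerCentralSeries_succ, Subgroup.commutator_le]
  exact fun x hx y _ => step2 x hx y

/-- In a finitely generated group every term of the lower central series is finitely generated
modulo the next one. -/
theorem exists_finite_closure_sup (S : Set G) (hfin : S.Finite)
    (hS : Subgroup.closure S = ⊤) (j : ℕ) :
    ∃ L : Set G, L.Finite ∧ L ⊆ Subgroup.lowerCentralSeries (⊤ : Subgroup G) j ∧
      Subgroup.lowerCentralSeries (⊤ : Subgroup G) j ≤
      Subgroup.closure L ⊔ Subgroup.lowerCentralSeries (⊤ : Subgroup G) (j + 1) := by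
  induction j with
  | zero => exact ⟨S, hfin, fun x _ => Subgroup.mem_top x, by simp [hS]⟩
  | succ j ih =>
    obtain ⟨L, hLf, hLj, hL⟩ := ih
    refine ⟨_, hLf.image2 _ hfin, ?_, lowerCentralSeries_succ_le_closure_sup hS hLj hL⟩
    rintro _ ⟨x, hx, s, _, rfl⟩
    exact commutatorElement_mem_lowerCentralSeries (j := 0) (hLj hx) (Subgroup.mem_top _)

end LowerCentralSeries


/-! ### Weighted words and the upper bound for the volume growth -/

section WeightedWords

variable {G : Type*} [Group G]

/-- `HasCost T ε c x` says that `x` is the value of a word of total cost at most `c`, where `T` is a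
set of letters `(t, j)` and each use of `t` or `t⁻¹` costs `ε ^ (j + 1)`.  Here `j` records that `t`
lies in the term `j` of the lower central series, so `j + 1` is the weight of `t`; at scale
`ε = 1 / n` a word of bounded cost uses `O(n ^ w)` letters of weight `w`. -/
inductive HasCost (T : Set (G × ℕ)) (ε : ℝ) : ℝ → G → Prop
  | one : HasCost T ε 0 1
  | letter {t : G} {j : ℕ} (h : (t, j) ∈ T) : HasCost T ε (ε ^ (j + 1)) t
  | inv_letter {t : G} {j : ℕ} (h : (t, j) ∈ T) : HasCost T ε (ε ^ (j + 1)) t⁻¹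
  | mul {c d : ℝ} {x y : G} (hx : HasCost T ε c x) (hy : HasCost T ε d y) :
      HasCost T ε (c + d) (x * y)
  | mono {c d : ℝ} {x : G} (hx : HasCost T ε c x) (h : c ≤ d) : HasCost T ε d x

variable {T : Set (G × ℕ)} {ε c : ℝ} {x g : G}

theorem HasCost.inv (h : HasCost T ε c x) : HasCost T ε c x⁻¹ := by
  induction h with
  | one => simpa using HasCost.one
  | letter h => exact .inv_letter h
  | inv_letter h => simpa using HasCost.letter h
  | mul _ _ h1 h2 => rw [mul_inv_rev, add_comm]; exact h2.mul h1
  | mono _ h h1 => exact h1.mono h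

theorem HasCost.nonneg (hε : 0 ≤ ε) (h : HasCost T ε c x) : 0 ≤ c := by
  induction h with
  | one => exact le_rfl
  | letter h => positivity
  | inv_letter h => positivity
  | mul _ _ h1 h2 => exact add_nonneg h1 h2
  | mono _ h h1 => exact h1.trans h

theorem HasCost.pow (h : HasCost T ε c x) (n : ℕ) : HasCost T ε (n * c) (x ^ n) := by
  induction n with
  | zero => simpa using HasCost.one
  | succ n ih =>
    rw [pow_succ, show ((n + 1 : ℕ) : ℝ) * c = n * c + c by push_cast; ring]
    exact ih.mul h

theorem HasCost.zpow (h : HasCost T ε c x) (n : ℤ) : HasCost T ε (n.natAbs * c) (x ^ n) := by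
  obtain ⟨m, rfl | rfl⟩ := n.eq_nat_or_neg
  · simpa using h.pow m
  · simpa using (h.pow m).inv

/-- Conjugation by an element that distorts each letter by the factor `1 + δ` distorts every word
by at most that factor. -/
theorem HasCost.conj {δ : ℝ} (hδ : 0 ≤ δ)
    (hg : ∀ y v, (y, v) ∈ T → HasCost T ε ((1 + δ) * ε ^ (v + 1)) (g⁻¹ * y * g))
    (h : HasCost T ε c x) : HasCost T ε ((1 + δ) * c) (g⁻¹ * x * g) := by
  induction h with
  | one => simpa using HasCost.one
  | letter h => exact hg _ _ h
  | inv_letter h =>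
    have := (hg _ _ h).inv
    simpa [mul_assoc] using this
  | @mul c d x y _ _ h1 h2 =>
    have := h1.mul h2
    rw [← mul_add] at this
    convert this using 1
    group
  | mono _ h h1 => exact h1.mono (by gcongr)

theorem HasCost.conj_pow {δ : ℝ} (hδ : 0 ≤ δ)
    (hg : ∀ y v, (y, v) ∈ T → HasCost T ε ((1 + δ) * ε ^ (v + 1)) (g⁻¹ * y * g))
    (h : HasCost T ε c x) (n : ℕ) :
    HasCost T ε ((1 + δ) ^ n * c) ((g ^ n)⁻¹ * x * g ^ n) := by
  induction n with
  | zero => simpa using h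
  | succ n ih =>
    have := ih.conj hδ hg
    rw [← mul_assoc, ← pow_succ'] at this
    convert this using 1
    rw [pow_succ]; group

theorem HasCost.conj_zpow {δ : ℝ} (hδ : 0 ≤ δ)
    (hg : ∀ y v, (y, v) ∈ T → HasCost T ε ((1 + δ) * ε ^ (v + 1)) (g⁻¹ * y * g))
    (hg' : ∀ y v, (y, v) ∈ T → HasCost T ε ((1 + δ) * ε ^ (v + 1)) (g * y * g⁻¹))
    (h : HasCost T ε c x) (n : ℤ) :
    HasCost T ε ((1 + δ) ^ n.natAbs * c) ((g ^ n)⁻¹ * x * g ^ n) := by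
  obtain ⟨m, rfl | rfl⟩ := n.eq_nat_or_neg
  · simpa using h.conj_pow hδ hg m
  · have := h.conj_pow (g := g⁻¹) hδ (by simpa using hg') m
    simpa using this

/-- A word in `T` and `g` equals `g ^ a` times a word in `T`: moving the occurrences of `g` to the
left conjugates the rest of the word by powers of `g`. -/
theorem HasCost.exists_zpow_mul {δ : ℝ} {j : ℕ} (hδ : 0 ≤ δ) (hε : 0 ≤ ε)
    (hg : ∀ y v, (y, v) ∈ T → HasCost T ε ((1 + δ) * ε ^ (v + 1)) (g⁻¹ * y * g))
    (hg' : ∀ y v, (y, v) ∈ T → HasCost T ε ((1 + δ) * ε ^ (v + 1)) (g * y * g⁻¹))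
    (h : HasCost (insert (g, j) T) ε c x) :
    ∃ (a : ℤ) (n : ℕ) (y : G), a.natAbs ≤ n ∧ n * ε ^ (j + 1) ≤ c ∧ x = g ^ a * y ∧
      HasCost T ε ((1 + δ) ^ n * c) y := by
  have h1 : (1 : ℝ) ≤ 1 + δ := by linarith
  induction h with
  | one => exact ⟨0, 0, 1, by simp, by simp, by simp, by simpa using HasCost.one⟩
  | @letter t i h =>
    rcases h with h | h
    · obtain ⟨rfl, rfl⟩ := Prod.mk.inj h
      exact ⟨1, 1, 1, by simp, by simp, by simp, HasCost.one.mono (by positivity)⟩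
    · exact ⟨0, 0, t, by simp, by simpa using by positivity, by simp, by simpa using .letter h⟩
  | @inv_letter t i h =>
    rcases h with h | h
    · obtain ⟨rfl, rfl⟩ := Prod.mk.inj h
      exact ⟨-1, 1, 1, by simp, by simp, by simp, HasCost.one.mono (by positivity)⟩
    · exact ⟨0, 0, t⁻¹, by simp, by simpa using by positivity, by simp,
        by simpa using .inv_letter h⟩
  | @mul c d x y hx hy h1 h2 =>
    obtain ⟨a, n, u, han, hn, rfl, hu⟩ := h1
    obtain ⟨b, m, v, hbm, hm, rfl, hv⟩ := h2
    have hc : 0 ≤ c := hx.nonneg hε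
    have hd : 0 ≤ d := hy.nonneg hε
    refine ⟨a + b, n + m, (g ^ b)⁻¹ * u * g ^ b * v, by omega, ?_, ?_, ?_⟩
    · push_cast; rw [add_mul]; exact add_le_add hn hm
    · rw [zpow_add]; group
    · have := (hu.conj_zpow hδ hg hg' b).mul hv
      refine this.mono ?_
      have e1 : (1 + δ) ^ b.natAbs ≤ (1 + δ) ^ m := pow_le_pow_right₀ h1 hbm
      have e2 : (1 + δ) ^ m ≤ (1 + δ) ^ (n + m) := pow_le_pow_right₀ h1 (by omega)
      have e3 : (1 + δ) ^ b.natAbs * ((1 + δ) ^ n * c) ≤ (1 + δ) ^ (n + m) * c := by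
        rw [pow_add, ← mul_assoc, mul_comm ((1 + δ) ^ n)]
        gcongr
      nlinarith [mul_le_mul_of_nonneg_right e2 hd]
  | mono _ h h1 =>
    obtain ⟨a, n, u, han, hn, rfl, hu⟩ := h1
    exact ⟨a, n, u, han, hn.trans h, rfl, hu.mono (by gcongr)⟩

/-- An element of the group generated by the letters of weight at least `j + 1` has cost
`O(ε ^ (j + 1))`, uniformly in the scale. -/
theorem exists_hasCost_of_mem_closure {j : ℕ}
    (hx : x ∈ Subgroup.closure {t | ∃ v, j ≤ v ∧ (t, v) ∈ T}) :
    ∃ κ : ℝ, 0 ≤ κ ∧ ∀ ε : ℝ, 0 ≤ ε → ε ≤ 1 → HasCost T ε (κ * ε ^ (j + 1)) x := by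
  induction hx using Subgroup.closure_induction with
  | mem x hx =>
    obtain ⟨v, hv, h⟩ := hx
    refine ⟨1, zero_le_one, fun ε h0 h1 => (HasCost.letter h).mono ?_⟩
    rw [one_mul]
    exact pow_le_pow_of_le_one h0 h1 (by omega)
  | one => exact ⟨0, le_rfl, fun ε h0 h1 => by simpa using HasCost.one⟩
  | mul x y _ _ h1 h2 =>
    obtain ⟨κ, h0, h⟩ := h1
    obtain ⟨κ', h0', h'⟩ := h2
    refine ⟨κ + κ', by positivity, fun ε e0 e1 => ?_⟩
    rw [add_mul]
    exact (h ε e0 e1).mul (h' ε e0 e1)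
  | inv x _ h1 =>
    obtain ⟨κ, h0, h⟩ := h1
    exact ⟨κ, h0, fun ε e0 e1 => (h ε e0 e1).inv⟩

/-- The number of elements of bounded cost is `O(ε ^ (-d))`. -/
def CostGrowth (T : Set (G × ℕ)) (d : ℕ) : Prop :=
  ∀ c : ℝ, ∃ M : ℝ, ∀ ε : ℝ, 0 < ε → ε ≤ 1 →
    ∃ F : Finset G, (F.card : ℝ) * ε ^ d ≤ M ∧ ∀ x, HasCost T ε c x → x ∈ F

theorem costGrowth_empty : CostGrowth (∅ : Set (G × ℕ)) 0 := by
  refine fun c => ⟨1, fun ε h0 h1 => ⟨{1}, by simp, fun x hx => ?_⟩⟩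
  rw [Finset.mem_singleton]
  induction hx with
  | one => rfl
  | letter h => exact h.elim
  | inv_letter h => exact h.elim
  | mul _ _ h1 h2 => rw [h1, h2, one_mul]
  | mono _ _ h => exact h

theorem CostGrowth.mono {d d' : ℕ} (h : CostGrowth T d) (hd : d ≤ d') : CostGrowth T d' := by
  intro c
  obtain ⟨M, hM⟩ := h c
  refine ⟨M, fun ε h0 h1 => ?_⟩
  obtain ⟨F, hF, hx⟩ := hM ε h0 h1
  refine ⟨F, le_trans ?_ hF, hx⟩
  exact mul_le_mul_of_nonneg_left (pow_le_pow_of_le_one h0.le h1 hd) (Nat.cast_nonneg _)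

/-- The letters of `T` have weight at least `j + 1`, lie in the corresponding terms of the lower
central series, and generate each term of index at least `m`. -/
structure Adapted (T : Set (G × ℕ)) (j m : ℕ) : Prop where
  finite : T.Finite
  mem : ∀ t v, (t, v) ∈ T → t ∈ Subgroup.lowerCentralSeries (⊤ : Subgroup G) v ∧ j ≤ v
  le_closure : ∀ i, m ≤ i → Subgroup.lowerCentralSeries (⊤ : Subgroup G) i ≤
    Subgroup.closure {t | ∃ v, i ≤ v ∧ (t, v) ∈ T}

theorem Adapted.insert_letter {j : ℕ} (h : Adapted T j (j + 1))
    (hg : g ∈ Subgroup.lowerCentralSeries (⊤ : Subgroup G) j) :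
    Adapted (insert (g, j) T) j (j + 1) where
  finite := h.finite.insert _
  mem := by
    rintro t v (e | e)
    · obtain ⟨rfl, rfl⟩ := Prod.mk.inj e
      exact ⟨hg, le_rfl⟩
    · exact h.mem t v e
  le_closure i hi := (h.le_closure i hi).trans (Subgroup.closure_mono
    fun _ ⟨v, hv, ht⟩ => ⟨v, hv, Set.mem_insert_of_mem _ ht⟩)

/-- Conjugating a letter of weight `v + 1` by an element of weight `j + 1` changes it by a
commutator of weight `v + j + 2`, so the cost grows by a factor `1 + O(ε ^ (j + 1))` only. -/
theorem Adapted.exists_conj_bound {j : ℕ} (h : Adapted T j (j + 1))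
    (hg : g ∈ Subgroup.lowerCentralSeries (⊤ : Subgroup G) j) :
    ∃ K : ℝ, 0 ≤ K ∧ ∀ ε : ℝ, 0 ≤ ε → ε ≤ 1 → ∀ y v, (y, v) ∈ T →
      HasCost T ε ((1 + K * ε ^ (j + 1)) * ε ^ (v + 1)) (g⁻¹ * y * g) := by
  have key : ∀ p : G × ℕ, p ∈ T → ∃ κ : ℝ, 0 ≤ κ ∧ ∀ ε : ℝ, 0 ≤ ε → ε ≤ 1 →
      HasCost T ε (κ * ε ^ (p.2 + j + 1 + 1)) ⁅p.1⁻¹, g⁻¹⁆ := by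
    intro p hp
    apply exists_hasCost_of_mem_closure
    apply h.le_closure _ (by omega)
    exact commutatorElement_mem_lowerCentralSeries (inv_mem (h.mem p.1 p.2 hp).1) (inv_mem hg)
  choose! κ hκ0 hκ using key
  obtain ⟨K, hK⟩ := (h.finite.image κ).bddAbove
  refine ⟨max K 0, le_max_right _ _, fun ε h0 h1 y v hyv => ?_⟩
  have e : g⁻¹ * y * g = y * ⁅y⁻¹, g⁻¹⁆ := by rw [commutatorElement_def]; group
  rw [e]
  refine ((HasCost.letter hyv).mul (hκ _ hyv ε h0 h1)).mono ?_
  have hle : κ (y, v) ≤ max K 0 := (hK (Set.mem_image_of_mem κ hyv)).trans (le_max_left _ _)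
  have e2 : κ (y, v) * ε ^ (v + j + 1 + 1) = κ (y, v) * ε ^ (j + 1) * ε ^ (v + 1) := by ring
  rw [e2, add_mul, one_mul]
  gcongr

/-- Normal form at scale `ε` with respect to a letter of minimal weight. -/
theorem Adapted.exists_normal_form {j : ℕ} (h : Adapted T j (j + 1))
    (hg : g ∈ Subgroup.lowerCentralSeries (⊤ : Subgroup G) j) (c : ℝ) :
    ∃ c' : ℝ, ∀ ε : ℝ, 0 ≤ ε → ε ≤ 1 → ∀ x, HasCost (insert (g, j) T) ε c x →
      ∃ (a : ℤ) (y : G), (a.natAbs : ℝ) * ε ^ (j + 1) ≤ c ∧ x = g ^ a * y ∧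
        HasCost T ε c' y := by
  obtain ⟨K, hK0, hK⟩ := h.exists_conj_bound hg
  obtain ⟨K', hK0', hK'⟩ := h.exists_conj_bound (inv_mem hg)
  set L := max K K' with hL
  refine ⟨Real.exp (L * c) * c, fun ε h0 h1 x hx => ?_⟩
  have hc := hx.nonneg h0
  have hL0 : 0 ≤ L := hK0.trans (le_max_left _ _)
  obtain ⟨a, n, y, han, hn, rfl, hy⟩ := hx.exists_zpow_mul (δ := L * ε ^ (j + 1))
    (by positivity) h0
    (fun y v hyv => (hK ε h0 h1 y v hyv).mono (by gcongr; exact le_max_left _ _))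
    (fun y v hyv => by
      have := (hK' ε h0 h1 y v hyv).mono (d := (1 + L * ε ^ (j + 1)) * ε ^ (v + 1))
        (by gcongr; exact le_max_right _ _)
      simpa using this)
  refine ⟨a, y, le_trans ?_ hn, rfl, hy.mono ?_⟩
  · gcongr
  · gcongr
    calc (1 + L * ε ^ (j + 1)) ^ n ≤ (Real.exp (L * ε ^ (j + 1))) ^ n := by
          gcongr
          rw [add_comm]; exact Real.add_one_le_exp _
      _ = Real.exp (L * (n * ε ^ (j + 1))) := by rw [← Real.exp_nat_mul]; ring_nf
      _ ≤ Real.exp (L * c) := by gcongr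

/-- Adding a letter of weight `j + 1` raises the growth exponent by `j + 1`. -/
theorem CostGrowth.insert_letter {j d : ℕ} (hd : CostGrowth T d) (h : Adapted T j (j + 1))
    (hg : g ∈ Subgroup.lowerCentralSeries (⊤ : Subgroup G) j) :
    CostGrowth (insert (g, j) T) (d + (j + 1)) := by
  classical
  intro c
  obtain ⟨c', hc'⟩ := h.exists_normal_form hg c
  obtain ⟨M, hM⟩ := hd c'
  refine ⟨(2 * max c 0 + 1) * M, fun ε h0 h1 => ?_⟩
  obtain ⟨F, hF, hFx⟩ := hM ε h0 h1
  set N := ⌊max c 0 / ε ^ (j + 1)⌋₊ with hN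
  have hp : 0 < ε ^ (j + 1) := by positivity
  refine ⟨(Finset.Icc (-N : ℤ) N ×ˢ F).image fun p => g ^ p.1 * p.2, ?_, fun x hx => ?_⟩
  · have hcard : (((Finset.Icc (-N : ℤ) N ×ˢ F).image fun p => g ^ p.1 * p.2).card : ℝ) ≤
        (2 * N + 1) * F.card := by
      refine (Nat.cast_le.2 Finset.card_image_le).trans (le_of_eq ?_)
      rw [Finset.card_product, Int.card_Icc]
      rw [show ((N : ℤ) + 1 - -N).toNat = 2 * N + 1 by omega]
      push_cast; ring
    have hNε : (N : ℝ) * ε ^ (j + 1) ≤ max c 0 := by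
      rw [← le_div_iff₀ hp]
      exact Nat.floor_le (by positivity)
    have hpe : ε ^ (j + 1) ≤ 1 := pow_le_one₀ h0.le h1
    calc _ ≤ ((2 * N + 1) * F.card : ℝ) * ε ^ (d + (j + 1)) := by gcongr
      _ = (2 * (N * ε ^ (j + 1)) + ε ^ (j + 1)) * (F.card * ε ^ d) := by ring
      _ ≤ (2 * max c 0 + 1) * M := by gcongr
  · obtain ⟨a, y, ha, rfl, hy⟩ := hc' ε h0.le h1 x hx
    refine Finset.mem_image.2 ⟨(a, y), Finset.mem_product.2 ⟨?_, hFx y hy⟩, rfl⟩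
    have : a.natAbs ≤ N := by
      apply Nat.le_floor
      rw [le_div_iff₀ hp]
      exact ha.trans (le_max_left _ _)
    rw [Finset.mem_Icc]
    omega

/-- Adding a letter that has a power in the group generated by the other letters does not raise the
growth exponent: the exponent of the new letter can be reduced, at a bounded cost. -/
theorem CostGrowth.insert_letter_of_pow_mem {j d q : ℕ} (hd : CostGrowth T d) (h : Adapted T j (j + 1))
    (hg : g ∈ Subgroup.lowerCentralSeries (⊤ : Subgroup G) j) (hq : 0 < q)
    (hgq : g ^ q ∈ Subgroup.closure {t | ∃ v, j ≤ v ∧ (t, v) ∈ T}) :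
    CostGrowth (insert (g, j) T) d := by
  classical
  intro c
  obtain ⟨c', hc'⟩ := h.exists_normal_form hg c
  obtain ⟨κ, hκ0, hκ⟩ := exists_hasCost_of_mem_closure hgq
  obtain ⟨M, hM⟩ := hd (κ * c + c')
  refine ⟨q * M, fun ε h0 h1 => ?_⟩
  obtain ⟨F, hF, hFx⟩ := hM ε h0 h1
  refine ⟨(Finset.range q ×ˢ F).image fun p => g ^ p.1 * p.2, ?_, fun x hx => ?_⟩
  · have hcard : (((Finset.range q ×ˢ F).image fun p => g ^ p.1 * p.2).card : ℝ) ≤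
        q * F.card := by
      refine (Nat.cast_le.2 Finset.card_image_le).trans (le_of_eq ?_)
      rw [Finset.card_product, Finset.card_range]
      push_cast; ring
    calc _ ≤ (q * F.card : ℝ) * ε ^ d := by gcongr
      _ = q * (F.card * ε ^ d) := by ring
      _ ≤ q * M := by gcongr
  · obtain ⟨a, y, ha, rfl, hy⟩ := hc' ε h0.le h1 x hx
    have hqz : (0 : ℤ) < q := by exact_mod_cast hq
    have hmod := Int.emod_add_mul_ediv a q
    have hr0 := Int.emod_nonneg a hqz.ne'
    have hrq := Int.emod_lt_of_pos a hqz
    refine Finset.mem_image.2 ⟨((a % q).toNat, (g ^ q) ^ (a / q) * y),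
      Finset.mem_product.2 ⟨?_, hFx _ ?_⟩, ?_⟩
    · simp only [Finset.mem_range]; omega
    · refine (((hκ ε h0.le h1).zpow (a / q)).mul hy).mono ?_
      have hab : (a / q).natAbs ≤ a.natAbs := Int.natAbs_ediv_le_natAbs a q
      have : ((a / q).natAbs : ℝ) * ε ^ (j + 1) ≤ c := le_trans (by gcongr) ha
      calc ((a / q).natAbs : ℝ) * (κ * ε ^ (j + 1)) + c'
          = κ * ((a / q).natAbs * ε ^ (j + 1)) + c' := by ring
        _ ≤ κ * c + c' := by gcongr
    · simp only
      rw [← mul_assoc, ← zpow_natCast g (a % q).toNat, Int.toNat_of_nonneg hr0, ← zpow_natCast g q,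
        ← zpow_mul, ← zpow_add, hmod]

end WeightedWords


/-! ### The classes of the letters of one layer -/

section Layers

variable {G : Type*} [Group G]

/-- The class in `G_{j+1} / G_{j+2}`, written additively, of an element of `G_{j+1}`. -/
def layerClass (j : ℕ) (x : Subgroup.lowerCentralSeries (⊤ : Subgroup G) j) :
    Additive (LCSFactor G j) :=
  Additive.ofMul (QuotientGroup.mk x)

theorem layerClass_mul {j : ℕ} (x y : Subgroup.lowerCentralSeries (⊤ : Subgroup G) j) :
    layerClass j (x * y) = layerClass j x + layerClass j y := rfl

theorem layerClass_zpow {j : ℕ} (x : Subgroup.lowerCentralSeries (⊤ : Subgroup G) j) (n : ℤ) :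
    layerClass j (x ^ n) = n • layerClass j x := rfl

theorem layerClass_surjective (j : ℕ) : Function.Surjective (layerClass (G := G) j) :=
  fun y => QuotientGroup.mk_surjective y.toMul

theorem layerClass_eq_iff {j : ℕ} {x y : Subgroup.lowerCentralSeries (⊤ : Subgroup G) j} :
    layerClass j x = layerClass j y ↔
      (x : G)⁻¹ * y ∈ Subgroup.lowerCentralSeries (⊤ : Subgroup G) (j + 1) := by
  unfold layerClass
  rw [Additive.ofMul.apply_eq_iff_eq, QuotientGroup.eq, Subgroup.mem_subgroupOf]
  rfl

theorem layerClass_eq_zero_iff {j : ℕ} {x : Subgroup.lowerCentralSeries (⊤ : Subgroup G) j} :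
    layerClass j x = 0 ↔ (x : G) ∈ Subgroup.lowerCentralSeries (⊤ : Subgroup G) (j + 1) := by
  have h := layerClass_eq_iff (x := x) (y := 1)
  rw [show layerClass j (1 : Subgroup.lowerCentralSeries (⊤ : Subgroup G) j) = 0 from rfl] at h
  rw [h]
  simp

theorem module_finite_lcsFactor {S : Set G} (hfin : S.Finite) (hS : Subgroup.closure S = ⊤)
    (j : ℕ) : Module.Finite ℤ (Additive (LCSFactor G j)) := by
  obtain ⟨L, hLf, hLj, hL⟩ := exists_finite_closure_sup S hfin hS j
  refine ⟨Submodule.fg_def.2 ⟨layerClass j '' {x | (x : G) ∈ L},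
    (hLf.preimage Subtype.val_injective.injOn).image _, ?_⟩⟩
  rw [eq_top_iff]
  rintro y -
  obtain ⟨x, rfl⟩ := layerClass_surjective j y
  have key : ∀ g ∈ Subgroup.closure
      (L ∪ (Subgroup.lowerCentralSeries (⊤ : Subgroup G) (j + 1) : Set G)),
      ∃ h : g ∈ Subgroup.lowerCentralSeries (⊤ : Subgroup G) j, layerClass j ⟨g, h⟩ ∈
        Submodule.span ℤ (layerClass j '' {x | (x : G) ∈ L}) := by
    intro g hg
    induction hg using Subgroup.closure_induction with
    | mem g hg =>
      rcases hg with h | h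
      · exact ⟨hLj h, Submodule.subset_span ⟨⟨g, hLj h⟩, h, rfl⟩⟩
      · refine ⟨Subgroup.lowerCentralSeries_antitone _ (Nat.le_succ j) h, ?_⟩
        rw [layerClass_eq_zero_iff.2 h]
        exact zero_mem _
    | one => exact ⟨one_mem _, zero_mem _⟩
    | mul a b _ _ h1 h2 =>
      obtain ⟨h1, h1'⟩ := h1
      obtain ⟨h2, h2'⟩ := h2
      exact ⟨mul_mem h1 h2, add_mem h1' h2'⟩
    | inv a _ h1 =>
      obtain ⟨h1, h1'⟩ := h1
      exact ⟨inv_mem h1, neg_mem h1'⟩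
  have hx := hL x.2
  rw [← Subgroup.closure_eq (Subgroup.lowerCentralSeries (⊤ : Subgroup G) (j + 1)),
    ← Subgroup.closure_union] at hx
  exact (key x hx).2

/-- Adding to `T`, one by one, elements of `G_{j+1}`.  The letters that have no nonzero power in
the group generated by the preceding ones have linearly independent classes, and only these raise
the growth exponent. -/
theorem exists_costGrowth_layer {T : Set (G × ℕ)} {j d : ℕ} (hT : Adapted T (j + 1) (j + 1))
    (hd : CostGrowth T d) {L : Set G} (hLf : L.Finite)
    (hLj : L ⊆ Subgroup.lowerCentralSeries (⊤ : Subgroup G) j) :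
    ∃ (T' : Set (G × ℕ)) (n : ℕ) (b : Fin n → Additive (LCSFactor G j)),
      T ⊆ T' ∧ (∀ t ∈ L, (t, j) ∈ T') ∧ Adapted T' j (j + 1) ∧ LinearIndependent ℤ b ∧
      (∀ i, ∃ x : Subgroup.lowerCentralSeries (⊤ : Subgroup G) j,
        (x : G) ∈ Subgroup.closure {t | ∃ v, j ≤ v ∧ (t, v) ∈ T'} ∧ layerClass j x = b i) ∧
      CostGrowth T' (d + (j + 1) * n) := by
  induction L, hLf using Set.Finite.induction_on with
  | empty =>
    refine ⟨T, 0, Fin.elim0, subset_rfl, by simp, ⟨hT.finite, fun t v h => ?_, hT.le_closure⟩,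
      linearIndependent_empty_type, fun i => i.elim0, by simpa using hd⟩
    exact ⟨(hT.mem t v h).1, (Nat.le_succ j).trans (hT.mem t v h).2⟩
  | @insert g L _ _ ih =>
    obtain ⟨T', n, b, hTT', hLT', hA, hb, hbx, hg⟩ := ih ((Set.subset_insert _ _).trans hLj)
    have hgj : g ∈ Subgroup.lowerCentralSeries (⊤ : Subgroup G) j := hLj (Set.mem_insert _ _)
    have hmono : Subgroup.closure {t | ∃ v, j ≤ v ∧ (t, v) ∈ T'} ≤
        Subgroup.closure {t | ∃ v, j ≤ v ∧ (t, v) ∈ insert (g, j) T'} :=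
      Subgroup.closure_mono fun _ ⟨v, hv, ht⟩ => ⟨v, hv, Set.mem_insert_of_mem _ ht⟩
    have hL' : ∀ t ∈ insert g L, (t, j) ∈ insert (g, j) T' := by
      rintro t (rfl | ht)
      · exact Set.mem_insert _ _
      · exact Set.mem_insert_of_mem _ (hLT' t ht)
    have hsub := hTT'.trans (Set.subset_insert (g, j) T')
    by_cases hq : ∃ q : ℕ, 0 < q ∧ g ^ q ∈ Subgroup.closure {t | ∃ v, j ≤ v ∧ (t, v) ∈ T'}
    · obtain ⟨q, hq, hgq⟩ := hq
      refine ⟨insert (g, j) T', n, b, hsub, hL', hA.insert_letter hgj, hb, fun i => ?_,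
        hg.insert_letter_of_pow_mem hA hgj hq hgq⟩
      obtain ⟨x, hx, e⟩ := hbx i
      exact ⟨x, hmono hx, e⟩
    · refine ⟨insert (g, j) T', n + 1, Fin.cons (layerClass j ⟨g, hgj⟩) b, hsub, hL',
        hA.insert_letter hgj, ?_, ?_, ?_⟩
      · refine LinearIndependent.finCons' _ _ hb ?_
        intro c y hy hcy
        have key : ∃ x : Subgroup.lowerCentralSeries (⊤ : Subgroup G) j,
            (x : G) ∈ Subgroup.closure {t | ∃ v, j ≤ v ∧ (t, v) ∈ T'} ∧ layerClass j x = y := by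
          clear hcy
          induction hy using Submodule.span_induction with
          | mem y hy => obtain ⟨i, rfl⟩ := hy; exact hbx i
          | zero => exact ⟨1, one_mem _, rfl⟩
          | add y z _ _ h1 h2 =>
            obtain ⟨u, hu, rfl⟩ := h1
            obtain ⟨v, hv, rfl⟩ := h2
            exact ⟨u * v, mul_mem hu hv, rfl⟩
          | smul c y _ h1 =>
            obtain ⟨u, hu, rfl⟩ := h1
            exact ⟨u ^ c, zpow_mem hu c, rfl⟩
        obtain ⟨x, hx, hxy⟩ := key
        rw [← hxy, ← layerClass_zpow, ← layerClass_mul, layerClass_eq_zero_iff] at hcy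
        have hcl : g ^ c ∈ Subgroup.closure {t | ∃ v, j ≤ v ∧ (t, v) ∈ T'} := by
          have h1 := (hA.le_closure (j + 1) le_rfl).trans (Subgroup.closure_mono
            (k := {t | ∃ v, j ≤ v ∧ (t, v) ∈ T'})
            (fun t ⟨v, hv, ht⟩ => ⟨v, (Nat.le_succ j).trans hv, ht⟩)) hcy
          have h2 : g ^ c * (x : G) ∈ Subgroup.closure {t | ∃ v, j ≤ v ∧ (t, v) ∈ T'} := h1
          exact (Subgroup.mul_mem_cancel_right _ hx).1 h2
        by_contra hc
        refine hq ⟨c.natAbs, Int.natAbs_pos.2 hc, ?_⟩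
        rcases Int.natAbs_eq c with h | h
        · rw [h, zpow_natCast] at hcl; simpa using hcl
        · rw [h, zpow_neg, zpow_natCast] at hcl; simpa using inv_mem hcl
      · intro i
        refine Fin.cases ?_ (fun i => ?_) i
        · exact ⟨⟨g, hgj⟩, Subgroup.subset_closure ⟨j, le_rfl, Set.mem_insert _ _⟩, rfl⟩
        · obtain ⟨x, hx, e⟩ := hbx i
          exact ⟨x, hmono hx, by simpa using e⟩
      · have := hg.insert_letter hA hgj
        convert this using 1
        ring

/-- Letters for `G_{j+1}`, built up from the last nontrivial term of the lower central series, whose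
growth exponent is the contribution of `G_{j+1}` to `D(G)`. -/
theorem exists_adapted_costGrowth {S : Set G} (hfin : S.Finite) (hS : Subgroup.closure S = ⊤)
    {c : ℕ} (hc : Subgroup.lowerCentralSeries (⊤ : Subgroup G) c = ⊥) (i j : ℕ) (hij : j + i = c) :
    ∃ T : Set (G × ℕ), Adapted T j j ∧
      CostGrowth T (∑ l ∈ Finset.Ico j c, (l + 1) * lcsRank G l) := by
  induction i generalizing j with
  | zero =>
    obtain rfl : j = c := by omega
    refine ⟨∅, ⟨Set.finite_empty, fun t v h => h.elim, fun i hi => ?_⟩, by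
      simpa using costGrowth_empty⟩
    exact (Subgroup.lowerCentralSeries_antitone _ hi).trans (hc.le.trans bot_le)
  | succ i ih =>
    obtain ⟨T, hT, hd⟩ := ih (j + 1) (by omega)
    obtain ⟨L, hLf, hLj, hL⟩ := exists_finite_closure_sup S hfin hS j
    obtain ⟨T', n, b, hTT', hLT', hA, hb, -, hg⟩ := exists_costGrowth_layer hT hd hLf hLj
    refine ⟨T', ⟨hA.finite, hA.mem, fun m hm => ?_⟩, hg.mono ?_⟩
    · rcases hm.eq_or_lt with rfl | hm
      · refine hL.trans (sup_le (Subgroup.closure_mono fun t ht => ⟨j, le_rfl, hLT' t ht⟩) ?_)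
        exact (hA.le_closure (j + 1) le_rfl).trans (Subgroup.closure_mono
            (fun t ⟨v, hv, ht⟩ => ⟨v, (Nat.le_succ j).trans hv, ht⟩))
      · exact hA.le_closure m hm
    · have := module_finite_lcsFactor hfin hS j
      have hn : n ≤ lcsRank G j := by
        have := hb.fintype_card_le_finrank
        rwa [Fintype.card_fin] at this
      rw [Finset.sum_eq_sum_Ico_succ_bot (show j < c by omega), add_comm]
      gcongr

/-- In a finitely generated nilpotent group the `n`-th power of a finite set has `O(n ^ D(G))`
elements. -/
theorem exists_card_pow_le [Group.IsNilpotent G] {S : Set G} (hfin : S.Finite)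
    (hS : Subgroup.closure S = ⊤) {B : Set G} (hB : B.Finite) :
    ∃ M : ℝ, ∀ n : ℕ, 1 ≤ n → ∃ F : Finset G,
      (F.card : ℝ) ≤ M * (n : ℝ) ^ homogeneousDim G ∧ B ^ n ⊆ F := by
  obtain ⟨T, hT, hd⟩ := exists_adapted_costGrowth hfin hS
    (Subgroup.lowerCentralSeries_nilpotencyClass (G := G)) (Group.nilpotencyClass G) 0 (by simp)
  rw [← Finset.range_eq_Ico] at hd
  change CostGrowth T (homogeneousDim G) at hd
  have key : ∀ g ∈ B, ∃ κ : ℝ, 0 ≤ κ ∧ ∀ ε : ℝ, 0 ≤ ε → ε ≤ 1 → HasCost T ε (κ * ε ^ (0 + 1)) g :=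
    fun g _ => exists_hasCost_of_mem_closure (hT.le_closure 0 le_rfl (Subgroup.mem_top g))
  choose! κ _ hκ using key
  obtain ⟨K, hK⟩ := (hB.image κ).bddAbove
  obtain ⟨M, hM⟩ := hd K
  refine ⟨M, fun n hn => ?_⟩
  have hn' : (1 : ℝ) ≤ n := by exact_mod_cast hn
  obtain ⟨F, hF, hFx⟩ := hM (1 / n) (by positivity) (by rw [div_le_one (by positivity)]; exact hn')
  refine ⟨F, ?_, fun x hx => hFx x ?_⟩
  · rw [one_div, inv_pow, ← div_eq_mul_inv, div_le_iff₀ (by positivity)] at hF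
    exact hF
  · have hpow : ∀ (m : ℕ) (x : G), x ∈ B ^ m → HasCost T (1 / n) (m * (K * (1 / n))) x := by
      intro m
      induction m with
      | zero =>
        intro x hx
        rw [pow_zero, Set.mem_one] at hx
        subst hx
        exact HasCost.one.mono (by simp)
      | succ m ih =>
        intro x hx
        rw [pow_succ] at hx
        obtain ⟨y, hy, z, hz, rfl⟩ := Set.mem_mul.1 hx
        have hz' := hκ z hz (1 / n) (by positivity)
          (by rw [div_le_one (by positivity)]; exact hn')
        refine ((ih y hy).mul hz').mono ?_
        push_cast
        rw [add_mul, pow_one, one_mul]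
        have := hK (Set.mem_image_of_mem κ hz)
        gcongr
    refine (hpow n x hx).mono (le_of_eq ?_)
    field_simp

end Layers


/-! ### Large boxes of short elements -/

section Boxes

variable {G : Type*} [Group G]

/-- `B` is a symmetric generating set that contains the identity. -/
structure IsGenerating (B : Set G) : Prop where
  mem_one : (1 : G) ∈ B
  mem_inv : ∀ x ∈ B, x⁻¹ ∈ B
  closure_eq : Subgroup.closure B = ⊤

variable {B : Set G}

theorem IsGenerating.inv_mem_pow (hB : IsGenerating B) {n : ℕ} {x : G} (hx : x ∈ B ^ n) :
    x⁻¹ ∈ B ^ n := by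
  have h : B⁻¹ = B := by
    ext y
    exact ⟨fun h => by simpa using hB.mem_inv _ h, fun h => hB.mem_inv _ h⟩
  rw [← h, inv_pow, Set.inv_mem_inv]
  exact hx

theorem IsGenerating.mem_pow_of_le (hB : IsGenerating B) {m n : ℕ} (h : m ≤ n) {x : G}
    (hx : x ∈ B ^ m) : x ∈ B ^ n :=
  Set.pow_subset_pow_right hB.mem_one h hx

theorem mul_mem_setPow {m n : ℕ} {x y : G} (hx : x ∈ B ^ m) (hy : y ∈ B ^ n) :
    x * y ∈ B ^ (m + n) := by
  rw [pow_add]; exact Set.mul_mem_mul hx hy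

theorem pow_mem_setPow {m : ℕ} {x : G} (hx : x ∈ B ^ m) (n : ℕ) : x ^ n ∈ B ^ (m * n) := by
  rw [pow_mul]; exact Set.pow_mem_pow hx

theorem IsGenerating.zpow_mem_pow (hB : IsGenerating B) {n : ℕ} {x : G} (hx : x ∈ B ^ n) (m : ℤ) :
    x ^ m ∈ B ^ (n * m.natAbs) := by
  obtain ⟨k, rfl | rfl⟩ := m.eq_nat_or_neg
  · simpa using pow_mem_setPow hx k
  · simpa using hB.inv_mem_pow (pow_mem_setPow hx k)

theorem IsGenerating.commutatorElement_mem_pow (hB : IsGenerating B) {m n : ℕ} {x y : G}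
    (hx : x ∈ B ^ m) (hy : y ∈ B ^ n) : ⁅x, y⁆ ∈ B ^ (m + n + m + n) := by
  rw [commutatorElement_def]
  exact mul_mem_setPow (mul_mem_setPow (mul_mem_setPow hx hy) (hB.inv_mem_pow hx))
    (hB.inv_mem_pow hy)

theorem IsGenerating.exists_mem_pow (hB : IsGenerating B) (x : G) : ∃ n : ℕ, x ∈ B ^ n := by
  have hx : x ∈ Subgroup.closure B := hB.closure_eq ▸ Subgroup.mem_top x
  induction hx using Subgroup.closure_induction with
  | mem x hx => exact ⟨1, by simpa using hx⟩
  | one => exact ⟨0, by simp⟩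
  | mul x y _ _ h1 h2 =>
    obtain ⟨m, hm⟩ := h1
    obtain ⟨n, hn⟩ := h2
    exact ⟨m + n, mul_mem_setPow hm hn⟩
  | inv x _ h1 =>
    obtain ⟨m, hm⟩ := h1
    exact ⟨m, hB.inv_mem_pow hm⟩

/-- Modulo `G_{j+2}`, the powers `g ^ m` with `|m| ≤ r ^ (j + 1)` of an element `g` of `G_{j+1}`
are represented by elements of word length `O(r)`.  For a commutator `g = [x, y]`, write
`m = d r + e` and use that `[x ^ d, y ^ r] [x, y ^ e] = g ^ m` modulo `G_{j+2}`. -/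
theorem IsGenerating.exists_short_representative (hB : IsGenerating B) {j : ℕ} {g : G}
    (hg : g ∈ Subgroup.lowerCentralSeries (⊤ : Subgroup G) j) :
    ∃ C : ℕ, ∀ r : ℕ, 1 ≤ r → ∀ m : ℤ, m.natAbs ≤ r ^ (j + 1) →
      ∃ h ∈ Subgroup.lowerCentralSeries (⊤ : Subgroup G) j,
        (h : G ⧸ Subgroup.lowerCentralSeries (⊤ : Subgroup G) (j + 1)) = (g : G ⧸ _) ^ m ∧
        h ∈ B ^ (C * r) := by
  induction j generalizing g with
  | zero =>
    obtain ⟨n, hn⟩ := hB.exists_mem_pow g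
    refine ⟨n, fun r _ m hm => ⟨g ^ m, zpow_mem hg m, rfl, ?_⟩⟩
    rw [zero_add, pow_one] at hm
    exact hB.mem_pow_of_le (Nat.mul_le_mul_left n hm) (hB.zpow_mem_pow hn m)
  | succ j ih =>
    have hcen : ∀ z ∈ Subgroup.lowerCentralSeries (⊤ : Subgroup G) (j + 1),
        (z : G ⧸ Subgroup.lowerCentralSeries (⊤ : Subgroup G) (j + 1 + 1)) ∈ Subgroup.center _ :=
      fun z hz => mk_mem_center_of_mem_lowerCentralSeries hz
    rw [Subgroup.mem_lowerCentralSeries_succ_iff] at hg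
    induction hg using Subgroup.closure_induction with
    | mem g hg =>
      obtain ⟨x, hx, y, -, rfl⟩ := hg
      obtain ⟨C, hC⟩ := ih hx
      obtain ⟨p, hp⟩ := hB.exists_mem_pow x
      obtain ⟨q, hq⟩ := hB.exists_mem_pow y
      refine ⟨2 * C + 2 * p + 4 * q, fun r hr m hm => ?_⟩
      have hr0 : (0 : ℤ) < r := by exact_mod_cast hr
      have hmod := Int.emod_add_mul_ediv m r
      have he0 := Int.emod_nonneg m hr0.ne'
      have her := Int.emod_lt_of_pos m hr0
      set e := (m % r).toNat with hedef
      have hee : (e : ℤ) = m % r := Int.toNat_of_nonneg he0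
      have hd : (m / r).natAbs ≤ r ^ (j + 1) := by
        have hm' : |m| ≤ (r : ℤ) ^ (j + 1) * r := by
          rw [Int.abs_eq_natAbs, ← pow_succ]; exact_mod_cast hm
        have h1 : m / r ≤ (r : ℤ) ^ (j + 1) :=
          Int.ediv_le_of_le_mul hr0 ((le_abs_self m).trans hm')
        have h2 : -(r : ℤ) ^ (j + 1) ≤ m / r := by
          rw [Int.le_ediv_iff_mul_le hr0]
          linarith [neg_abs_le m]
        have h3 : |m / r| ≤ (r : ℤ) ^ (j + 1) := abs_le.2 ⟨h2, h1⟩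
        rw [Int.abs_eq_natAbs] at h3
        exact_mod_cast h3
      obtain ⟨h, hh, hhx, hhB⟩ := hC r hr (m / r) hd
      refine ⟨⁅h, y ^ r⁆ * ⁅x, y ^ e⁆, mul_mem
        (commutatorElement_mem_lowerCentralSeries (j := 0) hh (Subgroup.mem_top _))
        (commutatorElement_mem_lowerCentralSeries (j := 0) hx (Subgroup.mem_top _)), ?_, ?_⟩
      · obtain ⟨z, hz, rfl⟩ : ∃ z ∈ Subgroup.lowerCentralSeries (⊤ : Subgroup G) (j + 1),
            h = x ^ (m / r) * z := by
          refine ⟨(x ^ (m / r))⁻¹ * h, ?_, by group⟩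
          rw [← QuotientGroup.eq, hhx, QuotientGroup.mk_zpow]
        have hxy : ∀ n : ℤ, ∀ w : G, ⁅((x ^ n : G) : G ⧸ Subgroup.lowerCentralSeries
            (⊤ : Subgroup G) (j + 1 + 1)), (w : G ⧸ Subgroup.lowerCentralSeries
            (⊤ : Subgroup G) (j + 1 + 1))⁆ ∈ Subgroup.center _ := fun n w =>
          hcen _ (commutatorElement_mem_lowerCentralSeries (j := 0) (zpow_mem hx n)
            (Subgroup.mem_top w))
        have hz' := hcen z hz
        have c1 : ∀ a b z : G ⧸ Subgroup.lowerCentralSeries (⊤ : Subgroup G) (j + 1 + 1),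
            z ∈ Subgroup.center _ → ⁅a * z, b⁆ = ⁅a, b⁆ := by
          intro a b z hz
          have := Subgroup.mem_center_iff.1 hz b
          have h2 : z * b * z⁻¹ = b := by rw [← this]; group
          calc ⁅a * z, b⁆ = a * (z * b * z⁻¹) * a⁻¹ * b⁻¹ := by
                rw [commutatorElement_def]; group
            _ = ⁅a, b⁆ := by rw [h2, commutatorElement_def]
        have hx1 : ⁅((x : G) : G ⧸ Subgroup.lowerCentralSeries
            (⊤ : Subgroup G) (j + 1 + 1)), (y : G ⧸ Subgroup.lowerCentralSeries
            (⊤ : Subgroup G) (j + 1 + 1))⁆ ∈ Subgroup.center _ := by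
          simpa using hxy 1 y
        have hm1 : ∀ a b : G, ((⁅a, b⁆ : G) : G ⧸ Subgroup.lowerCentralSeries
            (⊤ : Subgroup G) (j + 1 + 1)) =
            ⁅(a : G ⧸ Subgroup.lowerCentralSeries (⊤ : Subgroup G) (j + 1 + 1)),
              (b : G ⧸ Subgroup.lowerCentralSeries (⊤ : Subgroup G) (j + 1 + 1))⁆ :=
          fun _ _ => rfl
        rw [QuotientGroup.mk_mul, hm1, hm1, hm1, QuotientGroup.mk_mul, c1 _ _ _ hz',
          QuotientGroup.mk_pow, QuotientGroup.mk_pow, ← zpow_natCast, ← zpow_natCast,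
          commutatorElement_zpow_of_mem_center (hxy _ _),
          commutatorElement_zpow_of_mem_center hx1, QuotientGroup.mk_zpow,
          zpow_commutatorElement_of_mem_center hx1, ← zpow_mul, ← zpow_add, hee]
        congr 1
        linarith
      · refine hB.mem_pow_of_le ?_ (mul_mem_setPow
          (hB.commutatorElement_mem_pow hhB (pow_mem_setPow hq r))
          (hB.commutatorElement_mem_pow hp (pow_mem_setPow hq e)))
        have h1 : e ≤ r := by omega
        nlinarith [Nat.mul_le_mul_left q h1, Nat.mul_le_mul_left p hr]
    | one => exact ⟨0, fun r hr m _ => ⟨1, one_mem _, (one_zpow m).symm, by simp⟩⟩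
    | mul a b ha hb h1 h2 =>
      obtain ⟨C, hC⟩ := h1
      obtain ⟨D, hD⟩ := h2
      refine ⟨C + D, fun r hr m hm => ?_⟩
      obtain ⟨h, hh, e, hl⟩ := hC r hr m hm
      obtain ⟨h', hh', e', hl'⟩ := hD r hr m hm
      refine ⟨h * h', mul_mem hh hh', ?_, by rw [add_mul]; exact mul_mem_setPow hl hl'⟩
      rw [QuotientGroup.mk_mul, e, e', QuotientGroup.mk_mul, Commute.mul_zpow]
      exact Subgroup.mem_center_iff.1 (hcen b hb) _
    | inv a ha h1 =>
      obtain ⟨C, hC⟩ := h1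
      refine ⟨C, fun r hr m hm => ?_⟩
      obtain ⟨h, hh, e, hl⟩ := hC r hr m hm
      exact ⟨h⁻¹, inv_mem hh, by rw [QuotientGroup.mk_inv, e, QuotientGroup.mk_inv, inv_zpow],
        hB.inv_mem_pow hl⟩

/-- Products of representatives of multiples of linearly independent classes are distinct, even
modulo the next term of the lower central series. -/
theorem exists_layer_box {N : G → ℝ} (hN1 : N 1 ≤ 0) (hN : ∀ x y, N (x * y) ≤ N x + N y)
    {j n : ℕ} {b : Fin n → Additive (LCSFactor G j)} (hb : LinearIndependent ℤ b)
    (I : Fin n → Finset ℤ) {β : ℝ}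
    (h : ∀ i, ∀ m ∈ I i, ∃ x : Subgroup.lowerCentralSeries (⊤ : Subgroup G) j,
      layerClass j x = m • b i ∧ N x ≤ β) :
    ∃ F : Finset G, (∀ x ∈ F, x ∈ Subgroup.lowerCentralSeries (⊤ : Subgroup G) j) ∧
      ∏ i, (I i).card ≤ F.card ∧ (∀ x ∈ F, N x ≤ n * β) ∧
      ∀ x ∈ F, ∀ y ∈ F,
        x⁻¹ * y ∈ Subgroup.lowerCentralSeries (⊤ : Subgroup G) (j + 1) → x = y := by
  classical
  choose! f hf hfN using h
  let P : (Fin n → ℤ) → Subgroup.lowerCentralSeries (⊤ : Subgroup G) j := fun m =>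
    (List.ofFn fun i => f i (m i)).prod
  have hsum : ∀ l : List (Subgroup.lowerCentralSeries (⊤ : Subgroup G) j),
      layerClass j l.prod = (l.map (layerClass j)).sum := by
    intro l
    induction l with
    | nil => rfl
    | cons a l ih => rw [List.prod_cons, layerClass_mul, ih, List.map_cons, List.sum_cons]
  have hPc : ∀ m ∈ Fintype.piFinset I, layerClass j (P m) = ∑ i, m i • b i := by
    intro m hm
    rw [hsum, List.map_ofFn, List.sum_ofFn]
    exact Finset.sum_congr rfl fun i _ => hf i _ (Fintype.mem_piFinset.1 hm i)
  have hPN : ∀ m ∈ Fintype.piFinset I, N (P m) ≤ n * β := by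
    intro m hm
    have key : ∀ l : List (Subgroup.lowerCentralSeries (⊤ : Subgroup G) j),
        (∀ x ∈ l, N x ≤ β) → N (l.prod : Subgroup.lowerCentralSeries (⊤ : Subgroup G) j) ≤
          l.length * β := by
      intro l
      induction l with
      | nil => intro _; simpa using hN1
      | cons a l ih =>
        intro hl
        rw [List.prod_cons, Subgroup.coe_mul, List.length_cons]
        have h1 := hl a (by simp)
        have h2 := ih fun x hx => hl x (by simp [hx])
        have h3 := hN a (l.prod : Subgroup.lowerCentralSeries (⊤ : Subgroup G) j)
        rw [Nat.cast_succ]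
        linarith
    have := key (List.ofFn fun i => f i (m i)) (by
      intro x hx
      obtain ⟨i, rfl⟩ := List.mem_ofFn.1 hx
      exact hfN i _ (Fintype.mem_piFinset.1 hm i))
    rwa [List.length_ofFn] at this
  have hinj : ∀ m ∈ Fintype.piFinset I, ∀ m' ∈ Fintype.piFinset I,
      layerClass j (P m) = layerClass j (P m') → m = m' := by
    intro m hm m' hm' h
    rw [hPc m hm, hPc m' hm', ← sub_eq_zero, ← Finset.sum_sub_distrib] at h
    simp_rw [← sub_smul] at h
    funext i
    exact sub_eq_zero.1 (Fintype.linearIndependent_iff.1 hb (fun i => m i - m' i) h i)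
  refine ⟨(Fintype.piFinset I).image fun m => (P m : G), ?_, ?_, ?_, ?_⟩
  · intro x hx
    obtain ⟨m, _, rfl⟩ := Finset.mem_image.1 hx
    exact (P m).2
  · rw [Finset.card_image_of_injOn, Fintype.card_piFinset]
    intro m hm m' hm' h
    exact hinj m hm m' hm' (congrArg _ (Subtype.ext h))
  · intro x hx
    obtain ⟨m, hm, rfl⟩ := Finset.mem_image.1 hx
    exact hPN m hm
  · intro x hx y hy h
    obtain ⟨m, hm, rfl⟩ := Finset.mem_image.1 hx
    obtain ⟨m', hm', rfl⟩ := Finset.mem_image.1 hy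
    rw [hinj m hm m' hm' (layerClass_eq_iff.2 h)]

/-- Products of boxes in the successive layers of the lower central series are distinct. -/
theorem exists_box_of_layers {N : G → ℝ} (hN1 : N 1 ≤ 0) (hN : ∀ x y, N (x * y) ≤ N x + N y)
    {c : ℕ} {κ : ℕ → ℕ} {β : ℕ → ℝ}
    (h : ∀ j < c, ∃ F : Finset G, (∀ x ∈ F, x ∈ Subgroup.lowerCentralSeries (⊤ : Subgroup G) j) ∧
      κ j ≤ F.card ∧ (∀ x ∈ F, N x ≤ β j) ∧
      ∀ x ∈ F, ∀ y ∈ F,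
        x⁻¹ * y ∈ Subgroup.lowerCentralSeries (⊤ : Subgroup G) (j + 1) → x = y) :
    ∃ Q : Finset G, ∏ j ∈ Finset.range c, κ j ≤ Q.card ∧
      ∀ x ∈ Q, N x ≤ ∑ j ∈ Finset.range c, β j := by
  classical
  have key : ∀ i j : ℕ, j + i = c → ∃ Q : Finset G,
      (∀ x ∈ Q, x ∈ Subgroup.lowerCentralSeries (⊤ : Subgroup G) j) ∧
      ∏ l ∈ Finset.Ico j c, κ l ≤ Q.card ∧ ∀ x ∈ Q, N x ≤ ∑ l ∈ Finset.Ico j c, β l := by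
    intro i
    induction i with
    | zero =>
      intro j hj
      obtain rfl : j = c := by omega
      refine ⟨{1}, ?_, by simp, by simpa using hN1⟩
      intro x hx
      rw [Finset.mem_singleton.1 hx]
      exact one_mem _
    | succ i ih =>
      intro j hj
      obtain ⟨Q, hQj, hQc, hQN⟩ := ih (j + 1) (by omega)
      obtain ⟨F, hFj, hFc, hFN, hF⟩ := h j (by omega)
      refine ⟨(F ×ˢ Q).image fun p => p.1 * p.2, ?_, ?_, ?_⟩
      · intro x hx
        obtain ⟨⟨a, b⟩, hab, rfl⟩ := Finset.mem_image.1 hx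
        obtain ⟨ha, hb⟩ := Finset.mem_product.1 hab
        exact mul_mem (hFj a ha) (Subgroup.lowerCentralSeries_antitone _ (Nat.le_succ j) (hQj b hb))
      · rw [Finset.card_image_of_injOn, Finset.card_product,
          Finset.prod_eq_prod_Ico_succ_bot (show j < c by omega)]
        · exact Nat.mul_le_mul hFc hQc
        · rintro ⟨a, b⟩ hab ⟨a', b'⟩ hab' e
          obtain ⟨ha, hb⟩ := Finset.mem_product.1 hab
          obtain ⟨ha', hb'⟩ := Finset.mem_product.1 hab'
          simp only at e ha hb ha' hb'
          have : a⁻¹ * a' = b * b'⁻¹ := by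
            rw [eq_mul_inv_iff_mul_eq, mul_assoc, ← e]; group
          have haa := hF a ha a' ha' (this ▸ mul_mem (hQj b hb) (inv_mem (hQj b' hb')))
          subst haa
          rw [mul_left_cancel e]
      · intro x hx
        obtain ⟨⟨a, b⟩, hab, rfl⟩ := Finset.mem_image.1 hx
        obtain ⟨ha, hb⟩ := Finset.mem_product.1 hab
        rw [Finset.sum_eq_sum_Ico_succ_bot (show j < c by omega)]
        exact (hN a b).trans (add_le_add (hFN a ha) (hQN b hb))
  obtain ⟨Q, _, h1, h2⟩ := key c 0 (by simp)
  rw [← Finset.range_eq_Ico] at h1 h2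
  exact ⟨Q, h1, h2⟩

theorem le_mul_of_mem_setPow {N : G → ℝ} (hN1 : N 1 ≤ 0) (hN : ∀ x y, N (x * y) ≤ N x + N y)
    {σ : ℝ} (hσ : ∀ x ∈ B, N x ≤ σ) {n : ℕ} {x : G} (hx : x ∈ B ^ n) : N x ≤ n * σ := by
  induction n generalizing x with
  | zero =>
    rw [pow_zero, Set.mem_one] at hx
    subst hx
    simpa using hN1
  | succ n ih =>
    rw [pow_succ] at hx
    obtain ⟨y, hy, z, hz, rfl⟩ := Set.mem_mul.1 hx
    push_cast
    linarith [hN y z, ih hy, hσ z hz]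

theorem card_Icc_one_natCast (k : ℕ) : (Finset.Icc (1 : ℤ) k).card = k := by
  rw [Int.card_Icc]; omega

theorem IsGenerating.exists_short_lift (hB : IsGenerating B) {j : ℕ}
    (v : Additive (LCSFactor G j)) :
    ∃ C : ℕ, ∀ r : ℕ, 1 ≤ r → ∀ m ∈ Finset.Icc (1 : ℤ) (r ^ (j + 1) : ℕ),
      ∃ x : Subgroup.lowerCentralSeries (⊤ : Subgroup G) j,
        layerClass j x = m • v ∧ (x : G) ∈ B ^ (C * r) := by
  obtain ⟨g, rfl⟩ := layerClass_surjective j v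
  obtain ⟨C, hC⟩ := hB.exists_short_representative g.2
  refine ⟨C, fun r hr m hm => ?_⟩
  rw [Finset.mem_Icc] at hm
  obtain ⟨h, hh, e, hl⟩ := hC r hr m (by omega)
  refine ⟨⟨h, hh⟩, ?_, hl⟩
  rw [← layerClass_zpow, layerClass_eq_iff, ← QuotientGroup.eq]
  exact e

/-- The box of a single layer: it has `r ^ ((j + 1) * rank)` elements of size `O(r)`. -/
theorem IsGenerating.exists_layer_box (hB : IsGenerating B) (j : ℕ) :
    ∃ C : ℕ, ∀ r : ℕ, 1 ≤ r → ∀ N : G → ℝ, N 1 ≤ 0 → (∀ x y, N (x * y) ≤ N x + N y) →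
      ∀ σ : ℝ, 0 ≤ σ → (∀ x ∈ B, N x ≤ σ) →
      ∃ F : Finset G, (∀ x ∈ F, x ∈ Subgroup.lowerCentralSeries (⊤ : Subgroup G) j) ∧
      r ^ ((j + 1) * lcsRank G j) ≤ F.card ∧ (∀ x ∈ F, N x ≤ C * r * σ) ∧
      ∀ x ∈ F, ∀ y ∈ F,
        x⁻¹ * y ∈ Subgroup.lowerCentralSeries (⊤ : Subgroup G) (j + 1) → x = y := by
  obtain ⟨b, hb⟩ := exists_linearIndependent_of_le_finrank
    (le_refl (Module.finrank ℤ (Additive (LCSFactor G j))))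
  choose C hC using fun i => hB.exists_short_lift (b i)
  refine ⟨lcsRank G j * ∑ i, C i, fun r hr N hN1 hN σ hσ0 hσ => ?_⟩
  obtain ⟨F, h1, h2, h3, h4⟩ := NilpotentWalk.exists_layer_box hN1 hN hb
    (fun _ => Finset.Icc (1 : ℤ) (r ^ (j + 1) : ℕ)) (β := (∑ i, C i : ℕ) * r * σ) (by
      intro i m hm
      obtain ⟨x, hx, hxl⟩ := hC i r hr m hm
      refine ⟨x, hx, (le_mul_of_mem_setPow hN1 hN hσ hxl).trans ?_⟩
      rw [Nat.cast_mul]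
      gcongr
      exact Finset.single_le_sum (f := C) (fun _ _ => Nat.zero_le _) (Finset.mem_univ i))
  refine ⟨F, h1, ?_, fun x hx => (h3 x hx).trans (le_of_eq ?_), h4⟩
  · rw [lcsRank, pow_mul]
    simpa only [card_Icc_one_natCast, Finset.prod_const, Finset.card_univ,
      Fintype.card_fin] using h2
  · rw [Nat.cast_mul, lcsRank]; ring

/-- The box of a layer that contains an element `g` of infinite order modulo the next term, where
the range of the exponent of `g` is longer by a factor `K` than scaling allows. -/
theorem IsGenerating.exists_layer_box_of_not_mem (hB : IsGenerating B) {j : ℕ}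
    [Module.Finite ℤ (Additive (LCSFactor G j))] {g : G}
    (hg : g ∈ Subgroup.lowerCentralSeries (⊤ : Subgroup G) j)
    (hgm : ∀ m : ℤ, m ≠ 0 → g ^ m ∉ Subgroup.lowerCentralSeries (⊤ : Subgroup G) (j + 1)) :
    ∃ C : ℕ, ∀ r : ℕ, 1 ≤ r → ∀ K : ℕ, ∀ N : G → ℝ, N 1 ≤ 0 →
      (∀ x y, N (x * y) ≤ N x + N y) → ∀ σ : ℝ, 0 ≤ σ → (∀ x ∈ B, N x ≤ σ) →
      (∀ m : ℕ, m ≤ K * r ^ (j + 1) → N (g ^ m) ≤ r * σ) →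
      ∃ F : Finset G, (∀ x ∈ F, x ∈ Subgroup.lowerCentralSeries (⊤ : Subgroup G) j) ∧
      K * r ^ ((j + 1) * lcsRank G j) ≤ F.card ∧ (∀ x ∈ F, N x ≤ C * r * σ) ∧
      ∀ x ∈ F, ∀ y ∈ F,
        x⁻¹ * y ∈ Subgroup.lowerCentralSeries (⊤ : Subgroup G) (j + 1) → x = y := by
  set v := layerClass j ⟨g, hg⟩ with hv
  have hv0 : LinearIndependent ℤ (fun _ : Unit => v) := by
    rw [Fintype.linearIndependent_iff]
    intro c hc i
    by_contra h
    rw [Fintype.sum_unique, hv, ← layerClass_zpow, layerClass_eq_zero_iff] at hc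
    exact hgm _ h hc
  set W := Submodule.span ℤ (Set.range fun _ : Unit => v) with hW
  obtain ⟨n, hn⟩ : ∃ n, n = Module.finrank ℤ (Additive (LCSFactor G j) ⧸ W) := ⟨_, rfl⟩
  have hrank : n + 1 = lcsRank G j := by
    have h1 := Submodule.finrank_quotient_add_finrank W
    rw [finrank_span_eq_card hv0, Fintype.card_unit, ← hn] at h1
    exact h1
  obtain ⟨b, hb⟩ := exists_linearIndependent_of_le_finrank hn.le
  choose u hu using fun i => Submodule.Quotient.mk_surjective W (b i)
  have hcons : LinearIndependent ℤ (Fin.cons v u : Fin (n + 1) → Additive (LCSFactor G j)) := by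
    have h1 : LinearIndependent ℤ (fun _ : Unit => (⟨v, Submodule.subset_span ⟨(), rfl⟩⟩ : W)) :=
      LinearIndependent.of_comp W.subtype hv0
    have h2 := h1.sumElim_of_quotient u (by simpa [Function.comp_def, hu] using hb)
    have h3 := h2.comp (Fin.cons (Sum.inl ()) Sum.inr : Fin (n + 1) → Unit ⊕ Fin n) (by
      rw [Fin.cons_injective_iff]
      exact ⟨by simp, Sum.inr_injective⟩)
    have h4 : (Fin.cons v u : Fin (n + 1) → Additive (LCSFactor G j)) =
        Sum.elim (fun _ : Unit => v) u ∘ Fin.cons (Sum.inl ()) Sum.inr := by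
      funext i
      refine Fin.cases ?_ (fun i => ?_) i <;> simp
    rw [h4]
    exact h3
  choose C hC using fun i => hB.exists_short_lift (u i)
  refine ⟨(n + 1) * (1 + ∑ i, C i), fun r hr K N hN1 hN σ hσ0 hσ hgN => ?_⟩
  obtain ⟨F, h1, h2, h3, h4⟩ := NilpotentWalk.exists_layer_box hN1 hN hcons
    (Fin.cons (Finset.Icc (1 : ℤ) (K * r ^ (j + 1) : ℕ))
      fun _ => Finset.Icc (1 : ℤ) (r ^ (j + 1) : ℕ)) (β := (1 + ∑ i, C i : ℕ) * r * σ) (by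
      intro i
      refine Fin.cases ?_ (fun i => ?_) i
      · intro m hm
        simp only [Fin.cons_zero, Finset.mem_Icc] at hm
        refine ⟨⟨g, hg⟩ ^ m, by rw [layerClass_zpow, Fin.cons_zero], ?_⟩
        obtain ⟨k, rfl⟩ := Int.eq_ofNat_of_zero_le (show 0 ≤ m by omega)
        rw [zpow_natCast]
        refine (hgN k (by omega)).trans ?_
        gcongr
        exact le_mul_of_one_le_left (Nat.cast_nonneg _) (by exact_mod_cast Nat.le_add_right 1 _)
      · intro m hm
        rw [Fin.cons_succ] at hm
        obtain ⟨x, hx, hxl⟩ := hC i r hr m hm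
        refine ⟨x, by rw [hx, Fin.cons_succ], (le_mul_of_mem_setPow hN1 hN hσ hxl).trans ?_⟩
        rw [Nat.cast_mul]
        gcongr
        exact (Finset.single_le_sum (f := C) (fun _ _ => Nat.zero_le _) (Finset.mem_univ i)).trans
          (Nat.le_add_left _ _))
  refine ⟨F, h1, ?_, fun x hx => (h3 x hx).trans (le_of_eq ?_), h4⟩
  · refine le_trans (le_of_eq ?_) h2
    rw [Fin.prod_univ_succ, ← hrank]
    simp only [Fin.cons_zero, Fin.cons_succ, card_Icc_one_natCast, Finset.prod_const,
      Finset.card_univ, Fintype.card_fin]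
    ring
  · push_cast; ring

/-- Volume lower bound: balls of radius `C * r` have at least `r ^ D(G)` elements. -/
theorem IsGenerating.exists_box [Group.IsNilpotent G] (hB : IsGenerating B) :
    ∃ C : ℕ, ∀ r : ℕ, 1 ≤ r → ∀ N : G → ℝ, N 1 ≤ 0 → (∀ x y, N (x * y) ≤ N x + N y) →
      ∀ σ : ℝ, 0 ≤ σ → (∀ x ∈ B, N x ≤ σ) →
      ∃ Q : Finset G, r ^ homogeneousDim G ≤ Q.card ∧ ∀ x ∈ Q, N x ≤ C * r * σ := by
  choose C hC using fun j => hB.exists_layer_box j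
  refine ⟨∑ j ∈ Finset.range (Group.nilpotencyClass G), C j,
    fun r hr N hN1 hN σ hσ0 hσ => ?_⟩
  obtain ⟨Q, h1, h2⟩ := exists_box_of_layers (c := Group.nilpotencyClass G) hN1 hN
    fun j _ => hC j r hr N hN1 hN σ hσ0 hσ
  refine ⟨Q, ?_, fun x hx => (h2 x hx).trans (le_of_eq ?_)⟩
  · rwa [Finset.prod_pow_eq_pow_sum] at h1
  · push_cast; rw [Finset.sum_mul, Finset.sum_mul]

/-- If the powers of `g`, an element of infinite order modulo the next term of the lower central
series, are shorter than scaling predicts, then so many more elements have size `O(r)`. -/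
theorem IsGenerating.exists_box_of_not_mem [Group.IsNilpotent G] (hB : IsGenerating B)
    (hBf : B.Finite) {l : ℕ} {g : G} (hg : g ∈ Subgroup.lowerCentralSeries (⊤ : Subgroup G) l)
    (hgm : ∀ m : ℤ, m ≠ 0 → g ^ m ∉ Subgroup.lowerCentralSeries (⊤ : Subgroup G) (l + 1)) :
    ∃ C : ℕ, ∀ r : ℕ, 1 ≤ r → ∀ K : ℕ, ∀ N : G → ℝ, N 1 ≤ 0 →
      (∀ x y, N (x * y) ≤ N x + N y) → ∀ σ : ℝ, 0 ≤ σ → (∀ x ∈ B, N x ≤ σ) →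
      (∀ m : ℕ, m ≤ K * r ^ (l + 1) → N (g ^ m) ≤ r * σ) →
      ∃ Q : Finset G, K * r ^ homogeneousDim G ≤ Q.card ∧ ∀ x ∈ Q, N x ≤ C * r * σ := by
  classical
  have hl : l < Group.nilpotencyClass G := by
    by_contra h
    have h0 : g ∈ Subgroup.lowerCentralSeries (⊤ : Subgroup G) (Group.nilpotencyClass G) :=
      Subgroup.lowerCentralSeries_antitone _ (not_lt.1 h) hg
    rw [Subgroup.lowerCentralSeries_nilpotencyClass, Subgroup.mem_bot] at h0
    exact hgm 1 one_ne_zero (by simp [h0])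
  have := module_finite_lcsFactor hBf hB.closure_eq l
  choose C hC using fun j => hB.exists_layer_box j
  obtain ⟨C', hC'⟩ := hB.exists_layer_box_of_not_mem hg hgm
  refine ⟨∑ j ∈ Finset.range (Group.nilpotencyClass G), max (C j) C',
    fun r hr K N hN1 hN σ hσ0 hσ hgN => ?_⟩
  obtain ⟨Q, h1, h2⟩ := exists_box_of_layers (c := Group.nilpotencyClass G)
    (κ := fun j => (if j = l then K else 1) * r ^ ((j + 1) * lcsRank G j))
    (β := fun j => (max (C j) C' : ℕ) * r * σ) hN1 hN (by
      intro j _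
      by_cases hj : j = l
      · subst hj
        obtain ⟨F, f1, f2, f3, f4⟩ := hC' r hr K N hN1 hN σ hσ0 hσ hgN
        refine ⟨F, f1, by simpa using f2, fun x hx => (f3 x hx).trans ?_, f4⟩
        gcongr
        exact le_max_right _ _
      · obtain ⟨F, f1, f2, f3, f4⟩ := hC j r hr N hN1 hN σ hσ0 hσ
        refine ⟨F, f1, by simpa [hj] using f2, fun x hx => (f3 x hx).trans ?_, f4⟩
        gcongr
        exact le_max_left _ _)
  refine ⟨Q, ?_, fun x hx => (h2 x hx).trans (le_of_eq ?_)⟩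
  · rw [Finset.prod_mul_distrib, Finset.prod_pow_eq_pow_sum, Finset.prod_ite_eq' ,
      if_pos (Finset.mem_range.2 hl)] at h1
    exact h1
  · push_cast; rw [Finset.sum_mul, Finset.sum_mul]

end Boxes


/-! ### Convolution powers of symmetric probability measures -/

section Convolution

variable {G : Type*} [Group G]

theorem summable_conv_term {f g : G → ℝ} (hf0 : ∀ x, 0 ≤ f x) (hg0 : ∀ x, 0 ≤ g x)
    (hf : Summable f) (hg : Summable g) (x : G) : Summable fun h => f h * g (h⁻¹ * x) := by
  refine Summable.of_nonneg_of_le (fun h => mul_nonneg (hf0 h) (hg0 _)) (fun h => ?_)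
    (hf.mul_right (∑' y, g y))
  exact mul_le_mul_of_nonneg_left (hg.le_tsum _ fun y _ => hg0 y) (hf0 h)

theorem conv_nonneg {f g : G → ℝ} (hf0 : ∀ x, 0 ≤ f x) (hg0 : ∀ x, 0 ≤ g x) (x : G) :
    0 ≤ conv f g x :=
  tsum_nonneg fun h => mul_nonneg (hf0 h) (hg0 _)

theorem hasSum_prod_conv {f g : G → ℝ} (hf0 : ∀ x, 0 ≤ f x) (hg0 : ∀ x, 0 ≤ g x) {a b : ℝ}
    (hf : HasSum f a) (hg : HasSum g b) :
    HasSum (fun p : G × G => f p.1 * g (p.1⁻¹ * p.2)) (a * b) := by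
  have h1 : HasSum (fun p : G × G => f p.1 * g p.2) (a * b) :=
    hf.mul hg (hf.summable.mul_of_nonneg hg.summable hf0 hg0)
  let e : G × G ≃ G × G :=
    { toFun := fun p => (p.1, p.1⁻¹ * p.2)
      invFun := fun p => (p.1, p.1 * p.2)
      left_inv := fun p => by simp
      right_inv := fun p => by simp }
  exact e.hasSum_iff.2 h1

theorem hasSum_conv {f g : G → ℝ} (hf0 : ∀ x, 0 ≤ f x) (hg0 : ∀ x, 0 ≤ g x) {a b : ℝ}
    (hf : HasSum f a) (hg : HasSum g b) : HasSum (conv f g) (a * b) := by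
  have h1 := hasSum_prod_conv hf0 hg0 hf hg
  have h2 := (Equiv.prodComm G G).hasSum_iff.2 h1
  exact h2.prod_fiberwise fun x => (summable_conv_term hf0 hg0 hf.summable hg.summable x).hasSum

theorem conv_assoc {f g h : G → ℝ} (hf0 : ∀ x, 0 ≤ f x) (hg0 : ∀ x, 0 ≤ g x)
    (hh0 : ∀ x, 0 ≤ h x) (hf : Summable f) (hg : Summable g) (hh : Summable h) :
    conv (conv f g) h = conv f (conv g h) := by
  funext x
  have hs : Summable (Function.uncurry fun y z : G => f y * g (y⁻¹ * z) * h (z⁻¹ * x)) := by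
    refine Summable.of_nonneg_of_le
      (fun p => mul_nonneg (mul_nonneg (hf0 _) (hg0 _)) (hh0 _)) (fun p => ?_)
      ((hasSum_prod_conv hf0 hg0 hf.hasSum hg.hasSum).summable.mul_right (∑' y, h y))
    exact mul_le_mul_of_nonneg_left (hh.le_tsum _ fun y _ => hh0 y)
      (mul_nonneg (hf0 _) (hg0 _))
  unfold conv
  calc ∑' z, (∑' y, f y * g (y⁻¹ * z)) * h (z⁻¹ * x)
      = ∑' z, ∑' y, f y * g (y⁻¹ * z) * h (z⁻¹ * x) := by simp_rw [tsum_mul_right]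
    _ = ∑' y, ∑' z, f y * g (y⁻¹ * z) * h (z⁻¹ * x) := hs.tsum_comm
    _ = ∑' y, f y * ∑' w, g w * h (w⁻¹ * (y⁻¹ * x)) := by
      refine tsum_congr fun y => ?_
      rw [← tsum_mul_left, ← (Equiv.mulLeft y).tsum_eq]
      refine tsum_congr fun w => ?_
      simp [mul_assoc]

/-- A symmetric probability measure, given by its mass function. -/
structure IsSymmProb (μ : G → ℝ) : Prop where
  nonneg : ∀ x, 0 ≤ μ x
  hasSum : HasSum μ 1
  symm : ∀ x, μ x⁻¹ = μ x

theorem conv_convPow_zero (μ : G → ℝ) : conv (convPow μ 0) μ = μ := by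
  funext x
  unfold conv
  rw [tsum_eq_single 1]
  · simp [convPow]
  · intro h hh
    simp [convPow, hh]

variable {μ : G → ℝ}

theorem convPow_one (μ : G → ℝ) : convPow μ 1 = μ := conv_convPow_zero μ

theorem IsSymmProb.convPow_nonneg (hμ : IsSymmProb μ) (n : ℕ) (x : G) : 0 ≤ convPow μ n x := by
  induction n generalizing x with
  | zero => simp only [convPow]; split_ifs <;> simp
  | succ n ih => exact conv_nonneg ih hμ.nonneg x

theorem IsSymmProb.hasSum_convPow (hμ : IsSymmProb μ) (n : ℕ) : HasSum (convPow μ n) 1 := by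
  induction n with
  | zero => classical exact hasSum_ite_eq 1 1
  | succ n ih =>
    have := hasSum_conv (hμ.convPow_nonneg n) hμ.nonneg ih hμ.hasSum
    rwa [one_mul] at this

theorem IsSymmProb.conv_convPow (hμ : IsSymmProb μ) (m n : ℕ) :
    conv (convPow μ m) (convPow μ n) = convPow μ (m + n) := by
  induction n with
  | zero =>
    funext x
    unfold conv
    rw [tsum_eq_single x]
    · simp [convPow]
    · intro h hh
      have : h⁻¹ * x ≠ 1 := fun e => hh (inv_mul_eq_one.1 e)
      simp [convPow, this]
  | succ n ih =>
    change conv (convPow μ m) (conv (convPow μ n) μ) = conv (convPow μ (m + n)) μ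
    rw [← ih, conv_assoc (hμ.convPow_nonneg m) (hμ.convPow_nonneg n) hμ.nonneg
      (hμ.hasSum_convPow m).summable (hμ.hasSum_convPow n).summable hμ.hasSum.summable]

theorem IsSymmProb.convPow_inv (hμ : IsSymmProb μ) (n : ℕ) (x : G) :
    convPow μ n x⁻¹ = convPow μ n x := by
  induction n generalizing x with
  | zero => by_cases h : x = 1 <;> simp [convPow, h]
  | succ n ih =>
    have h1 := hμ.conv_convPow 1 n
    rw [convPow_one, add_comm] at h1
    rw [← congrFun h1 x]
    change conv (convPow μ n) μ x⁻¹ = conv μ (convPow μ n) x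
    unfold conv
    rw [← (Equiv.mulLeft x⁻¹).tsum_eq]
    refine tsum_congr fun h => ?_
    rw [Equiv.coe_mulLeft, ← ih (x⁻¹ * h), ← hμ.symm h]
    simp [mul_comm]

theorem IsSymmProb.convPow_two_mul (hμ : IsSymmProb μ) (n : ℕ) (x : G) :
    HasSum (fun h => convPow μ n h * convPow μ n (x⁻¹ * h)) (convPow μ (2 * n) x) := by
  rw [two_mul, ← hμ.conv_convPow n n]
  have := (summable_conv_term (hμ.convPow_nonneg n) (hμ.convPow_nonneg n)
    (hμ.hasSum_convPow n).summable (hμ.hasSum_convPow n).summable x).hasSum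
  unfold conv
  convert this using 2 with h
  rw [← hμ.convPow_inv n (x⁻¹ * h)]
  simp

/-- The function `x ↦ (2 (μ^{(2n)}(e) - μ^{(2n)}(x)))^{1/2}` is the `ℓ²` distance between
`μ^{(n)}` and its translate by `x`; in particular it is subadditive. -/
theorem IsSymmProb.exists_translation_dist (hμ : IsSymmProb μ) (n : ℕ) :
    ∃ N : G → ℝ, (∀ x, 0 ≤ N x) ∧ N 1 = 0 ∧ (∀ x y, N (x * y) ≤ N x + N y) ∧
      (∀ x, N x⁻¹ = N x) ∧
      ∀ x, N x ^ 2 = 2 * (convPow μ (2 * n) 1 - convPow μ (2 * n) x) := by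
  set f := convPow μ n with hf
  have hsq : Summable fun h => f h * f h := by
    simpa using (hμ.convPow_two_mul n 1).summable
  have hmem : ∀ x : G, Memℓp (fun h => f (x⁻¹ * h)) 2 := by
    intro x
    apply memℓp_gen
    have : Summable fun h => f (x⁻¹ * h) * f (x⁻¹ * h) :=
      (Equiv.mulLeft x⁻¹).summable_iff.2 hsq
    simpa [sq] using this
  let v : G → lp (fun _ : G => ℝ) 2 := fun x => ⟨fun h => f (x⁻¹ * h), hmem x⟩
  have hv : ∀ x y, ‖v x - v y‖ ^ 2 = ∑' h, (f (x⁻¹ * h) - f (y⁻¹ * h)) ^ 2 := by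
    intro x y
    have := lp.norm_rpow_eq_tsum (p := 2) (by simp) (v x - v y)
    simp only [ENNReal.toReal_ofNat, Real.rpow_ofNat, Real.norm_eq_abs, sq_abs] at this
    exact this
  have htrans : ∀ x y, ‖v x - v (x * y)‖ = ‖v 1 - v y‖ := by
    intro x y
    rw [← sq_eq_sq₀ (norm_nonneg _) (norm_nonneg _), hv, hv, ← (Equiv.mulLeft x).tsum_eq]
    refine tsum_congr fun h => ?_
    simp [mul_assoc]
  have hN : ∀ x, ‖v 1 - v x‖ ^ 2 = 2 * (convPow μ (2 * n) 1 - convPow μ (2 * n) x) := by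
    intro x
    rw [hv]
    have h1 := hμ.convPow_two_mul n 1
    have h2 := hμ.convPow_two_mul n x
    have h3 : HasSum (fun h => f (x⁻¹ * h) * f (x⁻¹ * h)) (convPow μ (2 * n) 1) := by
      rw [← (Equiv.mulLeft x⁻¹).hasSum_iff] at h1
      convert h1 using 2 with h
      simp [f]
    have h4 := (h1.add h3).sub (h2.mul_left 2)
    rw [show 2 * (convPow μ (2 * n) 1 - convPow μ (2 * n) x) = convPow μ (2 * n) 1 +
      convPow μ (2 * n) 1 - 2 * convPow μ (2 * n) x by ring, ← h4.tsum_eq]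
    refine tsum_congr fun h => ?_
    simp only [inv_one, one_mul, f]
    ring
  refine ⟨fun x => ‖v 1 - v x‖, fun x => norm_nonneg _, by simp, fun x y => ?_, fun x => ?_, hN⟩
  · beta_reduce
    rw [← htrans x y]
    exact norm_sub_le_norm_sub_add_norm_sub _ _ _
  · rw [← sq_eq_sq₀ (norm_nonneg _) (norm_nonneg _), hN, hN, hμ.convPow_inv]

theorem IsSymmProb.convPow_two_mul_le (hμ : IsSymmProb μ) (n : ℕ) (x : G) :
    convPow μ (2 * n) x ≤ convPow μ (2 * n) 1 := by
  obtain ⟨N, -, -, -, -, h⟩ := hμ.exists_translation_dist n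
  nlinarith [h x, sq_nonneg (N x)]

/-- Odd return probabilities are bounded by the preceding even ones. -/
theorem IsSymmProb.convPow_two_mul_add_one_le (hμ : IsSymmProb μ) (n : ℕ) :
    convPow μ (2 * n + 1) 1 ≤ convPow μ (2 * n) 1 := by
  have h1 : HasSum (fun h => convPow μ (2 * n) h * μ (h⁻¹ * 1)) (convPow μ (2 * n + 1) 1) :=
    (summable_conv_term (hμ.convPow_nonneg _) hμ.nonneg
    (hμ.hasSum_convPow _).summable hμ.hasSum.summable 1).hasSum
  have h2 := hμ.hasSum.mul_left (convPow μ (2 * n) 1)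
  rw [mul_one] at h2
  refine hasSum_le (fun h => ?_) h1 h2
  rw [mul_one, hμ.symm]
  exact mul_le_mul_of_nonneg_right (hμ.convPow_two_mul_le n h) (hμ.nonneg h)

/-- The decrease of the return probability dominates the Dirichlet form of `μ` at `μ^{(n)}`. -/
theorem IsSymmProb.sum_le_sub (hμ : IsSymmProb μ) (n : ℕ) (A : Finset G) :
    μ 1 * ∑ h ∈ A, μ h * (convPow μ (2 * n) 1 - convPow μ (2 * n) h) ≤
      convPow μ (2 * n) 1 - convPow μ (2 * (n + 1)) 1 := by
  have h0 : HasSum (fun h => convPow μ (2 * n) h * convPow μ 2 h)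
      (convPow μ (2 * (n + 1)) 1) := by
    rw [mul_add, mul_one, ← hμ.conv_convPow (2 * n) 2]
    have := (summable_conv_term (hμ.convPow_nonneg (2 * n)) (hμ.convPow_nonneg 2)
      (hμ.hasSum_convPow _).summable (hμ.hasSum_convPow _).summable 1).hasSum
    unfold conv
    convert this using 2 with h
    rw [mul_one, hμ.convPow_inv]
  have h1 := ((hμ.hasSum_convPow 2).mul_left (convPow μ (2 * n) 1)).sub h0
  rw [mul_one] at h1
  have hpos : ∀ h, 0 ≤ convPow μ (2 * n) 1 - convPow μ (2 * n) h := fun h =>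
    sub_nonneg.2 (hμ.convPow_two_mul_le n h)
  have h2 : ∀ h, μ 1 * μ h ≤ convPow μ 2 h := by
    intro h
    have hs := summable_conv_term hμ.nonneg hμ.nonneg hμ.hasSum.summable hμ.hasSum.summable h
    have h3 := hs.le_tsum 1 fun y _ => mul_nonneg (hμ.nonneg _) (hμ.nonneg _)
    have h4 : convPow μ 2 = conv μ μ := by
      change conv (convPow μ 1) μ = _
      rw [convPow_one]
    rw [h4]
    simpa [conv] using h3
  calc μ 1 * ∑ h ∈ A, μ h * (convPow μ (2 * n) 1 - convPow μ (2 * n) h)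
      = ∑ h ∈ A, μ 1 * μ h * (convPow μ (2 * n) 1 - convPow μ (2 * n) h) := by
        rw [Finset.mul_sum]; simp_rw [mul_assoc]
    _ ≤ ∑ h ∈ A, (convPow μ (2 * n) 1 * convPow μ 2 h -
          convPow μ (2 * n) h * convPow μ 2 h) := by
        refine Finset.sum_le_sum fun h _ => ?_
        rw [← sub_mul, mul_comm (_ - _) (convPow μ 2 h)]
        exact mul_le_mul_of_nonneg_right (h2 h) (hpos h)
    _ ≤ _ := by
        refine sum_le_hasSum A (fun h _ => ?_) h1
        rw [← sub_mul]
        exact mul_nonneg (hpos h) (hμ.convPow_nonneg 2 h)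

/-- If `μ^{(2n)}` falls below its value at the identity by at most `b` on a finite set `Q`, then the
return probability exceeds the mean of `μ^{(2n)}` over `Q`, which is at most `1 / |Q|`, by at most
`b`. -/
theorem IsSymmProb.convPow_le_of_finset (hμ : IsSymmProb μ) (n : ℕ) {b : ℝ} {Q : Finset G}
    (hQ : Q.Nonempty)
    (h : ∀ x ∈ Q, convPow μ (2 * n) 1 - convPow μ (2 * n) x ≤ b) :
    convPow μ (2 * n) 1 ≤ b + 1 / Q.card := by
  have hcard : (0 : ℝ) < Q.card := by exact_mod_cast hQ.card_pos
  have h1 : ∑ x ∈ Q, (convPow μ (2 * n) 1 - convPow μ (2 * n) x) ≤ Q.card * b := by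
    have := Finset.sum_le_sum h
    simpa using this
  have h2 : ∑ x ∈ Q, convPow μ (2 * n) x ≤ 1 :=
    sum_le_hasSum Q (fun x _ => hμ.convPow_nonneg _ x) (hμ.hasSum_convPow (2 * n))
  rw [Finset.sum_sub_distrib, Finset.sum_const, nsmul_eq_mul] at h1
  have h3 : Q.card * convPow μ (2 * n) 1 ≤ Q.card * (b + 1 / Q.card) := by
    rw [mul_add, mul_one_div_cancel hcard.ne']
    linarith
  exact le_of_mul_le_mul_left h3 hcard

end Convolution


/-! ### The lower bound for simple random walk -/

section LowerBound

variable {G : Type*} [Group G] {μ : G → ℝ}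

/-- The convolution operator of `μ`, cut off to a finite set. -/
def cutOp (μ : G → ℝ) (Ω : Finset G) (u : G → ℝ) (y : G) : ℝ := ∑ z ∈ Ω, u z * μ (z⁻¹ * y)

theorem sum_cutOp_mul (hμ : IsSymmProb μ) (Ω : Finset G) (u v : G → ℝ) :
    ∑ x ∈ Ω, cutOp μ Ω u x * v x = ∑ x ∈ Ω, u x * cutOp μ Ω v x := by
  unfold cutOp
  simp_rw [Finset.sum_mul, Finset.mul_sum]
  rw [Finset.sum_comm]
  refine Finset.sum_congr rfl fun x _ => Finset.sum_congr rfl fun y _ => ?_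
  rw [← hμ.symm (x⁻¹ * y), mul_inv_rev, inv_inv]
  ring

theorem sum_iterate_cutOp_mul (hμ : IsSymmProb μ) (Ω : Finset G) (u v : G → ℝ) (m : ℕ) :
    ∑ x ∈ Ω, (cutOp μ Ω)^[m] u x * v x = ∑ x ∈ Ω, u x * (cutOp μ Ω)^[m] v x := by
  induction m generalizing u v with
  | zero => rfl
  | succ m ih => rw [Function.iterate_succ_apply, ih, sum_cutOp_mul hμ,
      ← Function.iterate_succ_apply' (cutOp μ Ω) m v]

/-- Paths that stay in `Ω` are among all paths. -/
theorem iterate_cutOp_le (hμ : IsSymmProb μ) (Ω : Finset G) {f : G → ℝ} (hf : ∀ x, 0 ≤ f x)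
    (n : ℕ) {y : G} (hy : y ∈ Ω) :
    (cutOp μ Ω)^[n] f y ≤ ∑ x ∈ Ω, f x * convPow μ n (x⁻¹ * y) := by
  induction n generalizing y with
  | zero =>
    have h := Finset.single_le_sum (f := fun x => f x * convPow μ 0 (x⁻¹ * y))
      (fun x _ => mul_nonneg (hf x) (hμ.convPow_nonneg _ _)) hy
    simpa [convPow] using h
  | succ n ih =>
    rw [Function.iterate_succ_apply']
    calc cutOp μ Ω ((cutOp μ Ω)^[n] f) y
        ≤ ∑ z ∈ Ω, (∑ x ∈ Ω, f x * convPow μ n (x⁻¹ * z)) * μ (z⁻¹ * y) :=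
          Finset.sum_le_sum fun z hz => mul_le_mul_of_nonneg_right (ih hz) (hμ.nonneg _)
      _ = ∑ x ∈ Ω, f x * ∑ z ∈ Ω, convPow μ n (x⁻¹ * z) * μ (z⁻¹ * y) := by
          simp_rw [Finset.sum_mul, Finset.mul_sum, mul_assoc]
          rw [Finset.sum_comm]
      _ ≤ _ := by
          refine Finset.sum_le_sum fun x _ => mul_le_mul_of_nonneg_left ?_ (hf x)
          have hs := summable_conv_term (hμ.convPow_nonneg n) hμ.nonneg
            (hμ.hasSum_convPow n).summable hμ.hasSum.summable (x⁻¹ * y)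
          have h1 := ((Equiv.mulLeft x⁻¹).hasSum_iff.2 hs.hasSum)
          have h2 := sum_le_hasSum Ω
            (fun z _ => mul_nonneg (hμ.convPow_nonneg n _) (hμ.nonneg _)) h1
          refine le_trans (le_of_eq (Finset.sum_congr rfl fun z _ => ?_)) h2
          simp [mul_assoc]

/-- A test function on a finite set `Ω` whose Rayleigh quotient for the convolution operator is at
least `ρ` bounds the return probability from below by `ρ ^ (2 n) / |Ω|`. -/
theorem IsSymmProb.pow_le_card_mul_convPow (hμ : IsSymmProb μ) (Ω : Finset G) {f : G → ℝ}
    (hf : ∀ x, 0 ≤ f x) (hf0 : 0 < ∑ x ∈ Ω, f x * f x) {ρ : ℝ} (hρ : 0 < ρ)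
    (h : ρ * ∑ x ∈ Ω, f x * f x ≤ ∑ x ∈ Ω, cutOp μ Ω f x * f x) (n : ℕ) :
    ρ ^ (2 * n) ≤ Ω.card * convPow μ (2 * n) 1 := by
  set T := cutOp μ Ω with hT
  set b : ℕ → ℝ := fun k => ∑ x ∈ Ω, T^[k] f x * f x with hb
  have hadd : ∀ m k, ∑ x ∈ Ω, T^[m] f x * T^[k] f x = b (k + m) := by
    intro m k
    rw [← sum_iterate_cutOp_mul hμ, ← Function.iterate_add_apply]
  have hcs : ∀ m k, b (m + k) ^ 2 ≤ b (2 * m) * b (2 * k) := by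
    intro m k
    rw [add_comm, ← hadd, two_mul, two_mul, ← hadd, ← hadd]
    have := Finset.sum_mul_sq_le_sq_mul_sq Ω (T^[m] f) (T^[k] f)
    simpa only [sq] using this
  have hb0 : 0 < b 0 := hf0
  have hb1 : ρ * b 0 ≤ b 1 := h
  -- The moments `b (2 n)` are log-convex, so their successive ratios increase.
  have hstep : ∀ n, 0 < b (2 * n) ∧ ρ ^ 2 * b (2 * n) ≤ b (2 * (n + 1)) := by
    intro n
    induction n with
    | zero =>
      refine ⟨hb0, ?_⟩
      have h1 := hcs 0 1
      rw [zero_add, mul_zero, mul_one] at h1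
      rw [mul_zero, zero_add, mul_one]
      have h2 : (ρ * b 0) ^ 2 ≤ b 1 ^ 2 := pow_le_pow_left₀ (by positivity) hb1 2
      have h3 : b 0 * (ρ ^ 2 * b 0) ≤ b 0 * b 2 := by nlinarith
      exact le_of_mul_le_mul_left h3 hb0
    | succ n ih =>
      obtain ⟨h1, h2⟩ := ih
      have h3 : 0 < b (2 * (n + 1)) := lt_of_lt_of_le (by positivity) h2
      refine ⟨h3, ?_⟩
      have h4 := hcs n (n + 1 + 1)
      rw [show n + (n + 1 + 1) = 2 * (n + 1) by ring] at h4
      have h5 : b (2 * n) * (ρ ^ 2 * b (2 * (n + 1))) ≤ b (2 * n) * b (2 * (n + 1 + 1)) := by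
        refine le_trans ?_ h4
        nlinarith [mul_le_mul_of_nonneg_right h2 h3.le]
      exact le_of_mul_le_mul_left h5 h1
  have hpow : ρ ^ (2 * n) * b 0 ≤ b (2 * n) := by
    induction n with
    | zero => simp
    | succ n ih =>
      refine le_trans ?_ (hstep n).2
      rw [mul_add, pow_add, mul_one]
      nlinarith [mul_le_mul_of_nonneg_left ih (sq_nonneg ρ)]
  have hup : b (2 * n) ≤ convPow μ (2 * n) 1 * (Ω.card * b 0) := by
    have hp0 := hμ.convPow_nonneg (2 * n) 1
    calc b (2 * n) ≤ ∑ y ∈ Ω, (∑ x ∈ Ω, f x * convPow μ (2 * n) (x⁻¹ * y)) * f y :=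
          Finset.sum_le_sum fun y hy =>
            mul_le_mul_of_nonneg_right (iterate_cutOp_le hμ Ω hf _ hy) (hf y)
      _ ≤ ∑ y ∈ Ω, (∑ x ∈ Ω, f x * convPow μ (2 * n) 1) * f y := by
          refine Finset.sum_le_sum fun y _ => mul_le_mul_of_nonneg_right
            (Finset.sum_le_sum fun x _ => ?_) (hf y)
          exact mul_le_mul_of_nonneg_left (hμ.convPow_two_mul_le n _) (hf x)
      _ = convPow μ (2 * n) 1 * (∑ x ∈ Ω, f x) ^ 2 := by
          rw [← Finset.mul_sum, ← Finset.sum_mul]; ring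
      _ ≤ _ := by
          refine mul_le_mul_of_nonneg_left ?_ hp0
          have := sq_sum_le_card_mul_sum_sq (s := Ω) (f := f)
          simpa only [sq, b, Function.iterate_zero, id] using this
  have : ρ ^ (2 * n) * b 0 ≤ (Ω.card * convPow μ (2 * n) 1) * b 0 := by
    refine (hpow.trans hup).trans (le_of_eq ?_); ring
  exact le_of_mul_le_mul_right this hb0

/-- Word length with respect to `B`; it is only used for generating sets, so the set of admissible
lengths is nonempty. -/
noncomputable def wordLen (B : Set G) (x : G) : ℕ := sInf {n | x ∈ B ^ n}

variable {B : Set G}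

theorem IsGenerating.wordLen_le_iff (hB : IsGenerating B) {x : G} {n : ℕ} :
    wordLen B x ≤ n ↔ x ∈ B ^ n :=
  ⟨fun h => hB.mem_pow_of_le h (Nat.sInf_mem (hB.exists_mem_pow x)), fun h => Nat.sInf_le h⟩

theorem IsGenerating.wordLen_mul_le (hB : IsGenerating B) (x y : G) :
    wordLen B (x * y) ≤ wordLen B x + wordLen B y :=
  hB.wordLen_le_iff.2 (mul_mem_setPow (hB.wordLen_le_iff.1 le_rfl) (hB.wordLen_le_iff.1 le_rfl))

theorem IsGenerating.wordLen_le_add_one (hB : IsGenerating B) {x y : G} (h : x⁻¹ * y ∈ B) :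
    wordLen B y ≤ wordLen B x + 1 := by
  have h1 := hB.wordLen_mul_le x (x⁻¹ * y)
  rw [mul_inv_cancel_left] at h1
  have h2 : wordLen B (x⁻¹ * y) ≤ 1 := hB.wordLen_le_iff.2 (by simpa using h)
  omega

/-- The tent function `max (R - |x|, 0)` on the ball of radius `R` has Dirichlet energy at most half
the volume of the ball, for any symmetric probability measure carried by the generators. -/
theorem IsSymmProb.sum_tent_sub_le (hμ : IsSymmProb μ) (hB : IsGenerating B)
    (hsupp : ∀ x, x ∉ B → μ x = 0) (R : ℕ) {Ω : Finset G} (hΩ : ∀ x, x ∈ Ω ↔ x ∈ B ^ R) :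
    ∑ x ∈ Ω, ((R - wordLen B x : ℕ) : ℝ) * ((R - wordLen B x : ℕ) : ℝ) - Ω.card / 2 ≤
      ∑ x ∈ Ω, cutOp μ Ω (fun x => ((R - wordLen B x : ℕ) : ℝ)) x *
        ((R - wordLen B x : ℕ) : ℝ) := by
  set f : G → ℝ := fun x => ((R - wordLen B x : ℕ) : ℝ) with hf
  change ∑ x ∈ Ω, f x * f x - Ω.card / 2 ≤ ∑ x ∈ Ω, cutOp μ Ω f x * f x
  have hshift : ∀ x, HasSum (fun y => μ (x⁻¹ * y)) 1 := fun x =>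
    (Equiv.mulLeft x⁻¹).hasSum_iff.2 hμ.hasSum
  have hle : ∀ x, ∑ y ∈ Ω, μ (x⁻¹ * y) ≤ 1 := fun x =>
    sum_le_hasSum Ω (fun y _ => hμ.nonneg _) (hshift x)
  -- The neighbours of the support of the tent function stay in the ball.
  have hone : ∀ x, f x ≠ 0 → ∑ y ∈ Ω, μ (x⁻¹ * y) = 1 := by
    intro x hx
    rw [← (hshift x).tsum_eq, tsum_eq_sum]
    intro y hy
    apply hsupp
    intro h
    have h1 := hB.wordLen_le_add_one h
    have h2 : wordLen B x < R := by
      by_contra h2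
      exact hx (by simp [f, Nat.sub_eq_zero_of_le (not_lt.1 h2)])
    exact hy ((hΩ y).2 (hB.wordLen_le_iff.1 (by omega)))
  have hdiff : ∀ x y, (f x - f y) ^ 2 * μ (x⁻¹ * y) ≤ μ (x⁻¹ * y) := by
    intro x y
    by_cases h : x⁻¹ * y ∈ B
    · have h1 := hB.wordLen_le_add_one h
      have h2 : y⁻¹ * x ∈ B := by simpa using hB.mem_inv _ h
      have h3 := hB.wordLen_le_add_one h2
      have h4 : (R - wordLen B x) ≤ (R - wordLen B y) + 1 := by omega
      have h5 : (R - wordLen B y) ≤ (R - wordLen B x) + 1 := by omega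
      have h6 : f x ≤ f y + 1 := by simp only [f]; exact_mod_cast h4
      have h7 : f y ≤ f x + 1 := by simp only [f]; exact_mod_cast h5
      have h8 : (f x - f y) ^ 2 ≤ 1 := by nlinarith
      exact mul_le_of_le_one_left (hμ.nonneg _) h8
    · simp [hsupp _ h]
  have hsq : ∀ x, f x * f x * ∑ y ∈ Ω, μ (x⁻¹ * y) = f x * f x := by
    intro x
    by_cases hx : f x = 0
    · simp [hx]
    · rw [hone x hx, mul_one]
  have hs1 : ∑ x ∈ Ω, ∑ y ∈ Ω, f x * f x * μ (x⁻¹ * y) = ∑ x ∈ Ω, f x * f x := by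
    simp_rw [← Finset.mul_sum, hsq]
  have hs2 : ∑ x ∈ Ω, ∑ y ∈ Ω, f y * f y * μ (x⁻¹ * y) = ∑ x ∈ Ω, f x * f x := by
    rw [Finset.sum_comm, ← hs1]
    refine Finset.sum_congr rfl fun x _ => Finset.sum_congr rfl fun y _ => ?_
    rw [← hμ.symm (x⁻¹ * y), mul_inv_rev, inv_inv]
  have hs3 : ∑ x ∈ Ω, ∑ y ∈ Ω, f x * f y * μ (x⁻¹ * y) = ∑ x ∈ Ω, cutOp μ Ω f x * f x := by
    rw [Finset.sum_comm]
    unfold cutOp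
    simp_rw [Finset.sum_mul]
    refine Finset.sum_congr rfl fun x _ => Finset.sum_congr rfl fun y _ => ?_
    ring
  have hs4 : ∑ x ∈ Ω, ∑ y ∈ Ω, (f x - f y) ^ 2 * μ (x⁻¹ * y) ≤ Ω.card := by
    calc _ ≤ ∑ x ∈ Ω, ∑ y ∈ Ω, μ (x⁻¹ * y) :=
          Finset.sum_le_sum fun x _ => Finset.sum_le_sum fun y _ => hdiff x y
      _ ≤ ∑ x ∈ Ω, (1 : ℝ) := Finset.sum_le_sum fun x _ => hle x
      _ = Ω.card := by simp
  have hs5 : ∑ x ∈ Ω, ∑ y ∈ Ω, (f x - f y) ^ 2 * μ (x⁻¹ * y) =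
      ∑ x ∈ Ω, ∑ y ∈ Ω, f x * f x * μ (x⁻¹ * y) + ∑ x ∈ Ω, ∑ y ∈ Ω, f y * f y * μ (x⁻¹ * y) -
        2 * ∑ x ∈ Ω, ∑ y ∈ Ω, f x * f y * μ (x⁻¹ * y) := by
    simp_rw [Finset.mul_sum, ← Finset.sum_add_distrib, ← Finset.sum_sub_distrib]
    refine Finset.sum_congr rfl fun x _ => Finset.sum_congr rfl fun y _ => ?_
    ring
  rw [hs5, hs1, hs2, hs3] at hs4
  linarith

/-- A symmetric probability measure carried by a finite generating set of a nilpotent group has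
return probability at least of the order of `n ^ (-D(G) / 2)`. -/
theorem IsSymmProb.exists_pos_le_convPow [Group.IsNilpotent G] (hμ : IsSymmProb μ)
    (hB : IsGenerating B) (hBf : B.Finite) (hsupp : ∀ x, x ∉ B → μ x = 0) :
    ∃ c : ℝ, 0 < c ∧ ∀ n : ℕ, 1 ≤ n →
      c ≤ √n ^ homogeneousDim G * convPow μ (2 * n) 1 := by
  obtain ⟨M, hM⟩ := exists_card_pow_le hBf hB.closure_eq hBf
  obtain ⟨C, hC⟩ := hB.exists_box
  set D := homogeneousDim G with hD
  set E : ℝ := C + 1 with hE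
  have hE0 : 0 < E := by positivity
  set M' : ℝ := max M 1 with hM'
  have hM0 : 0 < M' := lt_of_lt_of_le one_pos (le_max_right _ _)
  -- The Rayleigh quotient of the tent function of radius `2 E r` is at least `1 - C₀ / r ^ 2`.
  set C₀ : ℝ := M' * (2 * E) ^ D / (2 * E ^ 2) with hC₀
  have hC₀0 : 0 < C₀ := by positivity
  have key : ∀ r : ℕ, 1 ≤ r → ∀ n : ℕ, 4 * C₀ * n ≤ (r : ℝ) ^ 2 → 2 * C₀ ≤ (r : ℝ) ^ 2 →
      1 / 2 ≤ M' * (2 * E * r) ^ D * convPow μ (2 * n) 1 := by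
    intro r hr n hn hr2
    have hr0 : (0 : ℝ) < r := by exact_mod_cast hr
    set R : ℕ := 2 * (C + 1) * r with hR
    have hRE : (R : ℝ) = 2 * E * r := by rw [hR, hE]; push_cast; ring
    obtain ⟨F, hF, hsub⟩ := hM R (Nat.succ_le_of_lt (by rw [hR]; positivity))
    set Ω : Finset G := (F.finite_toSet.subset hsub).toFinset with hΩ
    have hΩm : ∀ x, x ∈ Ω ↔ x ∈ B ^ R := fun x => Set.Finite.mem_toFinset _
    have hΩc : (Ω.card : ℝ) ≤ M' * (2 * E * r) ^ D := by
      have h1 : Ω ⊆ F := fun x hx => hsub ((hΩm x).1 hx)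
      rw [← hRE]
      calc (Ω.card : ℝ) ≤ F.card := by exact_mod_cast Finset.card_le_card h1
        _ ≤ M * (R : ℝ) ^ D := hF
        _ ≤ M' * (R : ℝ) ^ D := by gcongr; exact le_max_left _ _
    obtain ⟨Q, hQc, hQ⟩ := hC r hr (fun x => (wordLen B x : ℝ))
      (by
        have : wordLen B (1 : G) ≤ 0 := hB.wordLen_le_iff.2 (by simp)
        exact_mod_cast this)
      (fun x y => by exact_mod_cast hB.wordLen_mul_le x y) 1 zero_le_one
      (fun x hx => by exact_mod_cast hB.wordLen_le_iff.2 (by simpa using hx))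
    have hQ' : ∀ x ∈ Q, wordLen B x ≤ (C + 1) * r := by
      intro x hx
      have h1 := hQ x hx
      rw [mul_one] at h1
      have h2 : wordLen B x ≤ C * r := by exact_mod_cast h1
      nlinarith
    have hf0 : (r : ℝ) ^ D * (E * r) ^ 2 ≤
        ∑ x ∈ Ω, ((R - wordLen B x : ℕ) : ℝ) * ((R - wordLen B x : ℕ) : ℝ) := by
      calc (r : ℝ) ^ D * (E * r) ^ 2 ≤ Q.card * (E * r) ^ 2 := by
            gcongr; exact_mod_cast hQc
        _ = ∑ x ∈ Q, (E * r) * (E * r) := by rw [Finset.sum_const, nsmul_eq_mul]; ring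
        _ ≤ ∑ x ∈ Q, ((R - wordLen B x : ℕ) : ℝ) * ((R - wordLen B x : ℕ) : ℝ) := by
            refine Finset.sum_le_sum fun x hx => ?_
            have h1 : (C + 1) * r ≤ R - wordLen B x := by
              have := hQ' x hx
              have h2 : R = (C + 1) * r + (C + 1) * r := by rw [hR]; ring
              omega
            have h2 : E * r ≤ ((R - wordLen B x : ℕ) : ℝ) := by
              rw [hE]; exact_mod_cast h1
            gcongr
        _ ≤ _ := by
            refine Finset.sum_le_sum_of_subset_of_nonneg (fun x hx => ?_)
              (fun x _ _ => by positivity)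
            refine (hΩm x).2 (hB.wordLen_le_iff.1 ((hQ' x hx).trans ?_))
            rw [hR]; nlinarith
    set b := ∑ x ∈ Ω, ((R - wordLen B x : ℕ) : ℝ) * ((R - wordLen B x : ℕ) : ℝ) with hb
    have hb0 : 0 < b := lt_of_lt_of_le (by positivity) hf0
    have hρ : 0 < 1 - C₀ / (r : ℝ) ^ 2 := by
      have : C₀ / (r : ℝ) ^ 2 ≤ 1 / 2 := by
        rw [div_le_iff₀ (by positivity)]; linarith
      linarith
    have hray : (1 - C₀ / (r : ℝ) ^ 2) * b ≤ b - Ω.card / 2 := by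
      have h1 : (Ω.card : ℝ) / 2 ≤ C₀ / (r : ℝ) ^ 2 * b := by
        calc (Ω.card : ℝ) / 2 ≤ M' * (2 * E * r) ^ D / 2 := by gcongr
          _ = C₀ / (r : ℝ) ^ 2 * ((r : ℝ) ^ D * (E * r) ^ 2) := by
              rw [hC₀, mul_pow (2 * E) (r : ℝ) D]; field_simp
          _ ≤ _ := by gcongr
      linarith
    have h1 := hμ.pow_le_card_mul_convPow Ω (f := fun x => ((R - wordLen B x : ℕ) : ℝ))
      (fun x => by positivity) hb0 hρ (hray.trans (hμ.sum_tent_sub_le hB hsupp R hΩm)) n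
    have h2 : 1 / 2 ≤ (1 - C₀ / (r : ℝ) ^ 2) ^ (2 * n) := by
      have h3 := one_add_mul_le_pow (a := -(C₀ / (r : ℝ) ^ 2)) (by linarith) (2 * n)
      rw [← sub_eq_add_neg] at h3
      refine le_trans ?_ h3
      have h4 : C₀ / (r : ℝ) ^ 2 * (2 * n) ≤ 1 / 2 := by
        rw [div_mul_eq_mul_div, div_le_iff₀ (by positivity)]
        linarith
      push_cast
      linarith
    refine (h2.trans h1).trans ?_
    exact mul_le_mul_of_nonneg_right hΩc (hμ.convPow_nonneg _ _)
  set a : ℝ := √(4 * C₀) + 1 with ha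
  have ha0 : 0 < a := by positivity
  refine ⟨1 / 2 / (M' * (2 * E * (a + 1)) ^ D), by positivity, fun n hn => ?_⟩
  have hn1 : (1 : ℝ) ≤ √n := by
    rw [Real.one_le_sqrt]; exact_mod_cast hn
  have hr : a * √n ≤ (⌈a * √n⌉₊ : ℝ) := Nat.le_ceil _
  have hsq : 4 * C₀ * n ≤ (⌈a * √n⌉₊ : ℝ) ^ 2 := by
    calc 4 * C₀ * n = (√(4 * C₀) * √n) ^ 2 := by
          rw [mul_pow, Real.sq_sqrt (by positivity), Real.sq_sqrt (by positivity)]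
      _ ≤ (⌈a * √n⌉₊ : ℝ) ^ 2 := by
          refine pow_le_pow_left₀ (by positivity) (le_trans ?_ hr) 2
          rw [ha]; gcongr; linarith
  have hn' : (1 : ℝ) ≤ n := by exact_mod_cast hn
  have h1 := key ⌈a * √n⌉₊ (Nat.one_le_ceil_iff.2 (by positivity)) n hsq (by nlinarith)
  have hr2 : (⌈a * √n⌉₊ : ℝ) ≤ (a + 1) * √n := by
    have := (Nat.ceil_lt_add_one (show 0 ≤ a * √n by positivity)).le
    linarith
  rw [div_le_iff₀ (by positivity)]
  refine h1.trans ?_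
  have hp := hμ.convPow_nonneg (2 * n) 1
  calc M' * (2 * E * ⌈a * √n⌉₊) ^ D * convPow μ (2 * n) 1
      ≤ M' * (2 * E * ((a + 1) * √n)) ^ D * convPow μ (2 * n) 1 := by gcongr
    _ = √n ^ D * convPow μ (2 * n) 1 * (M' * (2 * E * (a + 1)) ^ D) := by
        rw [← mul_assoc (2 * E), mul_pow _ (√(n : ℝ))]; ring

open Classical in
theorem isSymmProb_uniformMeasure {A : Finset G} (hA : ∀ x ∈ A, x⁻¹ ∈ A) (hne : A.Nonempty) :
    IsSymmProb (uniformMeasure A) where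
  nonneg x := by unfold uniformMeasure; split_ifs <;> positivity
  hasSum := by
    have h : HasSum (uniformMeasure A) (∑ x ∈ A, uniformMeasure A x) :=
      hasSum_sum_of_ne_finset_zero fun x hx => by simp [uniformMeasure, hx]
    have hc : (A.card : ℝ) ≠ 0 := by exact_mod_cast hne.card_pos.ne'
    have h1 : ∑ x ∈ A, uniformMeasure A x = 1 := by
      rw [Finset.sum_congr rfl fun x hx => by rw [uniformMeasure, if_pos hx], Finset.sum_const,
        nsmul_eq_mul, mul_one_div_cancel hc]
    rwa [h1] at h
  symm x := by
    have : x⁻¹ ∈ A ↔ x ∈ A := ⟨fun h => by simpa using hA _ h, hA x⟩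
    simp [uniformMeasure, this]

/-- The return probability of simple random walk on a nilpotent group is at least of the order of
`n ^ (-D(G) / 2)`. -/
theorem exists_pos_le_convPow_uniformMeasure [Group.IsNilpotent G] {A : Finset G}
    (hA : ∀ x ∈ A, x⁻¹ ∈ A) (hne : A.Nonempty) (hgen : Subgroup.closure (A : Set G) = ⊤) :
    ∃ c : ℝ, 0 < c ∧ ∀ n : ℕ, 1 ≤ n →
      c ≤ √n ^ homogeneousDim G * convPow (uniformMeasure A) (2 * n) 1 := by
  refine (isSymmProb_uniformMeasure hA hne).exists_pos_le_convPow (B := insert 1 (A : Set G))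
    ⟨Set.mem_insert _ _, ?_, ?_⟩ (A.finite_toSet.insert 1) ?_
  · rintro x (rfl | hx)
    · simp
    · exact Set.mem_insert_of_mem _ (hA x hx)
  · exact top_le_iff.1 (hgen ▸ Subgroup.closure_mono (Set.subset_insert _ _))
  · intro x hx
    have : x ∉ A := fun h => hx (Set.mem_insert_of_mem _ h)
    simp [uniformMeasure, this]

end LowerBound


/-! ### From Nash inequalities to decay -/

section Decay

theorem tendsto_zero_of_le_add_half {x : ℕ → ℝ} (h0 : ∀ r, 0 ≤ x r)
    (h : ∀ ε > 0, ∃ R, ∀ r ≥ R, x r ≤ ε + x (r / 2) / 2) : Tendsto x atTop (𝓝 0) := by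
  obtain ⟨R, hR⟩ := h 1 one_pos
  obtain ⟨B, hB⟩ : ∃ B : ℝ, 2 ≤ B ∧ ∀ r, x r ≤ B := by
    have hR1 : ∀ r < R + 1, x r ≤ ∑ j ∈ Finset.range (R + 1), x j := fun r hr =>
      Finset.single_le_sum (fun j _ => h0 j) (Finset.mem_range.2 hr)
    refine ⟨max 2 (∑ j ∈ Finset.range (R + 1), x j), le_max_left _ _, fun r => ?_⟩
    induction r using Nat.strong_induction_on with
    | _ r ih =>
      by_cases hr : r < R + 1
      · exact (hR1 r hr).trans (le_max_right _ _)
      · have h1 := hR r (by omega)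
        have h2 := ih (r / 2) (by omega)
        have h3 : (2 : ℝ) ≤ max 2 (∑ j ∈ Finset.range (R + 1), x j) := le_max_left _ _
        linarith
  rw [Metric.tendsto_atTop]
  intro ε hε
  have key : ∀ i : ℕ, ∃ R, ∀ r ≥ R, x r ≤ 2 * (ε / 4) + B / 2 ^ i := by
    intro i
    induction i with
    | zero => exact ⟨0, fun r _ => by have := hB.2 r; simp; linarith⟩
    | succ i ih =>
      obtain ⟨R₁, h1⟩ := ih
      obtain ⟨R₂, h2⟩ := h (ε / 4) (by positivity)
      refine ⟨max (2 * R₁) R₂, fun r hr => ?_⟩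
      have h3 := h1 (r / 2) (by have := le_of_max_le_left hr; omega)
      have h4 := h2 r (le_of_max_le_right hr)
      have h5 : B / 2 ^ (i + 1) = B / 2 ^ i / 2 := by rw [pow_succ]; field_simp
      rw [h5]
      linarith
  have hlim : Tendsto (fun i : ℕ => B / 2 ^ i) atTop (𝓝 0) :=
    tendsto_const_nhds.div_atTop (tendsto_pow_atTop_atTop_of_one_lt one_lt_two)
  obtain ⟨i, hi⟩ := (hlim.eventually_lt_const (show 0 < ε / 4 by positivity)).exists
  obtain ⟨R, hR⟩ := key i
  refine ⟨R, fun r hr => ?_⟩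
  rw [Real.dist_eq, sub_zero, abs_of_nonneg (h0 r)]
  linarith [hR r hr]

/-- A decreasing sequence satisfying the inequality
`u n ≤ C r ^ 2 (u n - u (n + 1)) + 1 / (K r ^ D)` at all scales `r ≥ r₀(K)`, with `C` independent
of `K`, is `o(n ^ (-D / 2))`.  Running the inequality at scale `r` from time `M r ^ 2` to time
`4 M r ^ 2` bounds `x r = r ^ D u (M r ^ 2)` by `x (r / 2) / 2 + 3 ^ D / K`. -/
theorem tendsto_sqrt_pow_mul_of_nash {u : ℕ → ℝ} (h0 : ∀ n, 0 ≤ u n) (hu : Antitone u) (D : ℕ)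
    {C : ℝ} (hC : 1 ≤ C)
    (h : ∀ K : ℕ, 1 ≤ K → ∃ r₀ : ℕ, ∀ r ≥ r₀, ∀ n,
      u n ≤ C * (r : ℝ) ^ 2 * (u n - u (n + 1)) + 1 / (K * (r : ℝ) ^ D)) :
    Tendsto (fun n : ℕ => √n ^ D * u n) atTop (𝓝 0) := by
  have hC0 : 0 < C := by linarith
  obtain ⟨M, hM⟩ := exists_nat_ge (C * (2 * 3 ^ D))
  have hM0 : (0 : ℝ) < M := lt_of_lt_of_le (by positivity) hM
  have hMn : 0 < M := by exact_mod_cast hM0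
  have hexp : 3 ^ D * Real.exp (-(3 * M / C)) ≤ 1 / 2 := by
    have h1 : 2 * 3 ^ D ≤ 3 * M / C := by
      rw [le_div_iff₀ hC0]; nlinarith
    have h2 : 2 * 3 ^ D ≤ Real.exp (3 * M / C) := by
      linarith [Real.add_one_le_exp (3 * M / C)]
    rw [Real.exp_neg, ← div_eq_mul_inv, div_le_iff₀ (Real.exp_pos _)]
    linarith
  have hiter : ∀ K : ℕ, 1 ≤ K → ∃ r₀ : ℕ, ∀ r ≥ r₀, 1 ≤ r → ∀ n m,
      u (n + m) ≤ 1 / (K * (r : ℝ) ^ D) + Real.exp (-(m / (C * (r : ℝ) ^ 2))) * u n := by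
    intro K hK
    obtain ⟨r₀, hr₀⟩ := h K hK
    refine ⟨r₀, fun r hr hr1 n m => ?_⟩
    have hr1' : (1 : ℝ) ≤ r := by exact_mod_cast hr1
    set b := 1 / (K * (r : ℝ) ^ D) with hb
    have hb0 : 0 ≤ b := by positivity
    set θ := 1 / (C * (r : ℝ) ^ 2) with hθ
    have hCr : 1 ≤ C * (r : ℝ) ^ 2 := by nlinarith
    have hθ0 : 0 ≤ θ := by positivity
    have hθ1 : θ ≤ 1 := by rw [hθ, div_le_one (by positivity)]; exact hCr
    have hθC : θ * (C * (r : ℝ) ^ 2) = 1 := one_div_mul_cancel (by positivity)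
    have hstep : ∀ j, u (j + 1) - b ≤ (1 - θ) * (u j - b) := by
      intro j
      have h1 := mul_le_mul_of_nonneg_left (hr₀ r hr j) hθ0
      have h2 : θ * (C * (r : ℝ) ^ 2 * (u j - u (j + 1)) + b) =
          (u j - u (j + 1)) + θ * b := by
        rw [mul_add, ← mul_assoc, hθC, one_mul]
      rw [h2] at h1
      linarith
    have hpow : ∀ m, u (n + m) - b ≤ (1 - θ) ^ m * u n := by
      intro m
      induction m with
      | zero => simp [hb0]
      | succ m ih =>
        rw [← add_assoc]
        refine (hstep _).trans ?_
        rw [pow_succ', mul_assoc]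
        exact mul_le_mul_of_nonneg_left ih (by linarith)
    have hle : (1 - θ) ^ m ≤ Real.exp (-(m / (C * (r : ℝ) ^ 2))) := by
      calc (1 - θ) ^ m ≤ (Real.exp (-θ)) ^ m := by
            refine pow_le_pow_left₀ (by linarith) ?_ m
            linarith [Real.add_one_le_exp (-θ)]
        _ = Real.exp (-(m / (C * (r : ℝ) ^ 2))) := by
            rw [← Real.exp_nat_mul, hθ]; ring_nf
    have := hpow m
    have h3 := mul_le_mul_of_nonneg_right hle (h0 n)
    linarith
  have hx : Tendsto (fun r : ℕ => (r : ℝ) ^ D * u (M * r ^ 2)) atTop (𝓝 0) := by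
    refine tendsto_zero_of_le_add_half (fun r => mul_nonneg (by positivity) (h0 _)) ?_
    intro ε hε
    obtain ⟨K, hK⟩ := exists_nat_ge (3 ^ D / ε)
    have hK0 : (0 : ℝ) < K := lt_of_lt_of_le (by positivity) hK
    obtain ⟨r₀, hr₀⟩ := hiter K (by exact_mod_cast hK0)
    refine ⟨max (2 * r₀) 2, fun r' hr' => ?_⟩
    set r := r' / 2 with hr
    have hr1 : 1 ≤ r := by have := le_of_max_le_right hr'; omega
    have hrr : r₀ ≤ r := by have := le_of_max_le_left hr'; omega
    have hr0 : (0 : ℝ) < r := by exact_mod_cast hr1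
    have h1 := hr₀ r hrr hr1 (M * r ^ 2) (3 * M * r ^ 2)
    have h2 : u (M * r' ^ 2) ≤ u (M * r ^ 2 + 3 * M * r ^ 2) := by
      apply hu
      have h3 : 2 * r ≤ r' := by omega
      calc M * r ^ 2 + 3 * M * r ^ 2 = M * (2 * r) ^ 2 := by ring
        _ ≤ M * r' ^ 2 := by gcongr
    have h3 : ((3 * M * r ^ 2 : ℕ) : ℝ) / (C * (r : ℝ) ^ 2) = 3 * M / C := by
      push_cast; field_simp
    rw [h3] at h1
    have h4 : (r' : ℝ) ≤ 3 * r := by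
      have : r' ≤ 3 * r := by omega
      exact_mod_cast this
    have h5 : 3 ^ D / (K : ℝ) ≤ ε := by
      rw [div_le_iff₀ hK0]
      rw [div_le_iff₀ hε] at hK
      linarith
    calc (r' : ℝ) ^ D * u (M * r' ^ 2)
        ≤ (3 * r) ^ D * (1 / (K * (r : ℝ) ^ D) + Real.exp (-(3 * M / C)) * u (M * r ^ 2)) := by
          refine mul_le_mul (pow_le_pow_left₀ (by positivity) h4 D) (h2.trans h1) (h0 _)
            (by positivity)
      _ = 3 ^ D / K + (3 ^ D * Real.exp (-(3 * M / C))) * ((r : ℝ) ^ D * u (M * r ^ 2)) := by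
          rw [mul_pow]; field_simp
      _ ≤ ε + 1 / 2 * ((r : ℝ) ^ D * u (M * r ^ 2)) := by
          have := h0 (M * r ^ 2)
          gcongr
      _ = ε + (r : ℝ) ^ D * u (M * r ^ 2) / 2 := by ring
  have hsqrt : Tendsto (fun n : ℕ => Nat.sqrt (n / M)) atTop atTop := by
    refine tendsto_atTop.2 fun b => ?_
    filter_upwards [eventually_ge_atTop (b * b * M)] with n hn
    exact Nat.le_sqrt.2 ((Nat.le_div_iff_mul_le hMn).2 hn)
  have hx' := (hx.comp hsqrt).const_mul ((2 * √M) ^ D)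
  rw [mul_zero] at hx'
  refine tendsto_of_tendsto_of_tendsto_of_le_of_le' tendsto_const_nhds hx'
    (Eventually.of_forall fun n => mul_nonneg (by positivity) (h0 n)) ?_
  filter_upwards [hsqrt.eventually_ge_atTop 1] with n hn
  simp only [Function.comp]
  set r := Nat.sqrt (n / M) with hr
  have h1 : M * r ^ 2 ≤ n := by
    have := Nat.sqrt_le' (n / M)
    calc M * r ^ 2 ≤ M * (n / M) := Nat.mul_le_mul_left _ this
      _ ≤ n := Nat.mul_div_le n M
  have h2 : n ≤ M * (r + 1) ^ 2 := by
    have h3 : n / M + 1 ≤ (r + 1) ^ 2 := Nat.lt_succ_sqrt' (n / M)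
    calc n ≤ M * (n / M + 1) := (Nat.lt_mul_div_succ n hMn).le
      _ ≤ M * (r + 1) ^ 2 := Nat.mul_le_mul_left _ h3
  have h3 : √n ≤ 2 * √M * r := by
    have hn' : (1 : ℝ) ≤ r := by exact_mod_cast hn
    rw [Real.sqrt_le_left (by positivity), mul_pow, mul_pow, Real.sq_sqrt hM0.le]
    calc (n : ℝ) ≤ M * (r + 1) ^ 2 := by exact_mod_cast h2
      _ ≤ M * (2 * r) ^ 2 := by gcongr; linarith
      _ = 2 ^ 2 * M * (r : ℝ) ^ 2 := by ring
  calc √n ^ D * u n ≤ (2 * √M * r) ^ D * u (M * r ^ 2) :=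
        mul_le_mul (pow_le_pow_left₀ (by positivity) h3 D) (hu h1) (h0 _) (by positivity)
    _ = (2 * √M) ^ D * ((r : ℝ) ^ D * u (M * r ^ 2)) := by rw [mul_pow]; ring

end Decay

/-! ### Energy bounds along the powers of a generator -/

section PowerBounds

variable {y : ℕ → ℝ}

/-- Averages `y m ≤ y (m + j) + y j` over `m ≤ j < 2 m`; here `y m` stands for the size of the
`m`-th power of an element. -/
theorem sq_le_sum_Ico (h0 : ∀ m, 0 ≤ y m) (hsub : ∀ m j, y m ≤ y (m + j) + y j) {m : ℕ}
    (hm : 1 ≤ m) : y m ^ 2 ≤ 2 / m * ∑ j ∈ Finset.Ico m (3 * m), y j ^ 2 := by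
  have hm0 : (0 : ℝ) < m := by exact_mod_cast hm
  have h1 : ∀ j ∈ Finset.Ico m (2 * m), y m ^ 2 ≤ 2 * y (m + j) ^ 2 + 2 * y j ^ 2 := by
    intro j _
    nlinarith [hsub m j, h0 m, h0 j, h0 (m + j), sq_nonneg (y (m + j) - y j)]
  have h2 := Finset.sum_le_sum h1
  rw [Finset.sum_const, Nat.card_Ico, nsmul_eq_mul, show 2 * m - m = m by omega,
    Finset.sum_add_distrib, ← Finset.mul_sum, ← Finset.mul_sum,
    Finset.sum_Ico_add (fun j => y j ^ 2) m (2 * m) m] at h2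
  have h3 := Finset.sum_Ico_consecutive (fun j => y j ^ 2) (show m ≤ m + m by omega)
    (show m + m ≤ 3 * m by omega)
  rw [← h3, div_mul_eq_mul_div, le_div_iff₀ hm0]
  rw [show 2 * m = m + m by ring, show m + m + m = 3 * m by ring] at h2
  linarith

/-- Weights `(1 + j) ^ (-α - 1)` control the energy of a single power by its `α`-th power. -/
theorem sq_le_rpow_mul (h0 : ∀ m, 0 ≤ y m) (hsub : ∀ m j, y m ≤ y (m + j) + y j) {α V : ℝ}
    (hα : 0 < α)
    (hV : ∀ A : Finset ℕ, ∑ j ∈ A, (1 + (j : ℝ)) ^ (-α - 1) * y j ^ 2 ≤ V) {m : ℕ} (hm : 1 ≤ m) :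
    y m ^ 2 ≤ 2 * 3 ^ (α + 1) * (m : ℝ) ^ α * V := by
  have hm0 : (0 : ℝ) < m := by exact_mod_cast hm
  have h1 : ∑ j ∈ Finset.Ico m (3 * m), y j ^ 2 ≤ (3 * m : ℝ) ^ (α + 1) * V := by
    refine le_trans ?_ (mul_le_mul_of_nonneg_left (hV (Finset.Ico m (3 * m))) (by positivity))
    rw [Finset.mul_sum]
    refine Finset.sum_le_sum fun j hj => ?_
    have hj3 : (1 + (j : ℝ)) ≤ 3 * m := by
      have := (Finset.mem_Ico.1 hj).2
      have h2 : 1 + j ≤ 3 * m := by omega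
      exact_mod_cast h2
    have hj0 : (0 : ℝ) < 1 + j := by positivity
    rw [← mul_assoc]
    refine le_mul_of_one_le_left (sq_nonneg _) ?_
    rw [show -α - 1 = -(α + 1) by ring, Real.rpow_neg hj0.le, ← div_eq_mul_inv,
      one_le_div (by positivity)]
    exact Real.rpow_le_rpow hj0.le hj3 (by linarith)
  refine (sq_le_sum_Ico h0 hsub hm).trans ?_
  calc 2 / (m : ℝ) * ∑ j ∈ Finset.Ico m (3 * m), y j ^ 2
      ≤ 2 / (m : ℝ) * ((3 * m : ℝ) ^ (α + 1) * V) := by gcongr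
    _ = 2 * 3 ^ (α + 1) * (m : ℝ) ^ α * V := by
        rw [Real.mul_rpow (by norm_num) hm0.le, Real.rpow_add_one hm0.ne' α]
        field_simp

/-- For the critical weights `(1 + j) ^ (-3)` there is a logarithmic gain over quadratic growth:
the values at `m / 3 ^ i`, for `i < t`, each bound the value at `m`, and involve disjoint parts of
the sum. -/
theorem sq_le_div_mul_add (h0 : ∀ m, 0 ≤ y m) (hsub : ∀ m j, y m ≤ y (m + j) + y j)
    (hadd : ∀ m j, y (m + j) ≤ y m + y j) (hy0 : y 0 = 0) {V : ℝ}
    (hV : ∀ A : Finset ℕ, ∑ j ∈ A, (1 + (j : ℝ)) ^ (-2 - 1 : ℝ) * y j ^ 2 ≤ V) (m t : ℕ)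
    (ht : 1 ≤ t) : y m ^ 2 ≤ (108 / t * (m : ℝ) ^ 2 + 16 * 9 ^ t) * V := by
  have ht0 : (0 : ℝ) < t := by exact_mod_cast ht
  have hV0 : 0 ≤ V := by simpa using hV ∅
  have hmul : ∀ k j, y (k * j) ≤ k * y j := by
    intro k j
    induction k with
    | zero => simp [hy0]
    | succ k ih =>
      rw [add_mul, one_mul]
      push_cast
      linarith [hadd (k * j) j]
  have hy1 : y 1 ^ 2 ≤ 8 * V := by
    have h1 := hV {1}
    rw [Finset.sum_singleton] at h1
    have h2 : (1 + ((1 : ℕ) : ℝ)) ^ (-2 - 1 : ℝ) = 1 / 8 := by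
      rw [show (-2 - 1 : ℝ) = -((3 : ℕ) : ℝ) by norm_num, Real.rpow_neg (by norm_num),
        Real.rpow_natCast]
      norm_num
    rw [h2] at h1
    linarith
  set I : ℕ → Finset ℕ := fun i => Finset.Ico (m / 3 ^ i) (3 * (m / 3 ^ i)) with hI
  set S : ℕ → ℝ := fun i => ∑ j ∈ I i, (1 + (j : ℝ)) ^ (-2 - 1 : ℝ) * y j ^ 2 with hS
  have hS0 : ∀ i, 0 ≤ S i := fun i => Finset.sum_nonneg fun j _ => by positivity
  have hsum : ∑ i ∈ Finset.range t, S i ≤ V := by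
    rw [← Finset.sum_biUnion]
    · exact hV _
    · have hlt : ∀ i i', i < i' → Disjoint (I i) (I i') := by
        intro i i' hii
        rw [Finset.disjoint_left]
        intro j hj hj'
        have h1 := (Finset.mem_Ico.1 hj).1
        have h2 := (Finset.mem_Ico.1 hj').2
        have h3 : m / 3 ^ i' ≤ m / 3 ^ (i + 1) :=
          Nat.div_le_div_left (Nat.pow_le_pow_right (by norm_num) hii) (by positivity)
        rw [pow_succ, ← Nat.div_div_eq_div_mul] at h3
        omega
      intro i _ i' _ hne
      rcases lt_or_gt_of_ne hne with h | h
      · exact hlt i i' h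
      · exact (hlt i' i h).symm
  have hi : ∀ i ∈ Finset.range t, y m ^ 2 ≤ 108 * (m : ℝ) ^ 2 * S i + 16 * 9 ^ t * V := by
    intro i hit
    set k := m / 3 ^ i with hk
    have hkm : (3 : ℝ) ^ i * k ≤ m := by exact_mod_cast Nat.mul_div_le m (3 ^ i)
    have h1 : y m ≤ 3 ^ i * y k + 3 ^ i * y 1 := by
      have e : m = 3 ^ i * k + (m % 3 ^ i) * 1 := by rw [mul_one]; exact (Nat.div_add_mod m _).symm
      have h2 : y m ≤ y (3 ^ i * k) + y ((m % 3 ^ i) * 1) := by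
        conv_lhs => rw [e]
        exact hadd _ _
      have h3 := hmul (3 ^ i) k
      have h4 := hmul (m % 3 ^ i) 1
      have h5 : ((m % 3 ^ i : ℕ) : ℝ) ≤ 3 ^ i := by
        exact_mod_cast (Nat.mod_lt m (by positivity)).le
      have h6 := mul_le_mul_of_nonneg_right h5 (h0 1)
      push_cast at h3
      linarith
    have h2 : y m ^ 2 ≤ 2 * (3 ^ i * y k) ^ 2 + 2 * (3 ^ i * y 1) ^ 2 := by
      have := h0 m
      nlinarith [sq_nonneg (3 ^ i * y k - 3 ^ i * y 1)]
    have h3 : (3 ^ i * y k) ^ 2 ≤ 54 * (m : ℝ) ^ 2 * S i := by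
      rcases Nat.eq_zero_or_pos k with hk0 | hk0
      · rw [hk0, hy0, mul_zero, zero_pow two_ne_zero]
        have := hS0 i
        positivity
      · have hk1 : (0 : ℝ) < k := by exact_mod_cast hk0
        have h4 := sq_le_sum_Ico h0 hsub (m := k) hk0
        have h5 : ∑ j ∈ Finset.Ico k (3 * k), y j ^ 2 ≤ (3 * k : ℝ) ^ 3 * S i := by
          simp only [S, I, ← hk]
          rw [Finset.mul_sum]
          refine Finset.sum_le_sum fun j hj => ?_
          have hj3 : (1 + (j : ℝ)) ≤ 3 * k := by
            have := (Finset.mem_Ico.1 hj).2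
            have h2 : 1 + j ≤ 3 * k := by omega
            exact_mod_cast h2
          have hj0 : (0 : ℝ) < 1 + j := by positivity
          rw [← mul_assoc]
          refine le_mul_of_one_le_left (sq_nonneg _) ?_
          rw [show (-2 - 1 : ℝ) = -((3 : ℕ) : ℝ) by norm_num, Real.rpow_neg hj0.le,
            Real.rpow_natCast, ← div_eq_mul_inv, one_le_div (by positivity)]
          exact pow_le_pow_left₀ hj0.le hj3 3
        have h6 : y k ^ 2 ≤ 54 * (k : ℝ) ^ 2 * S i := by
          refine h4.trans ?_
          calc 2 / (k : ℝ) * ∑ j ∈ Finset.Ico k (3 * k), y j ^ 2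
              ≤ 2 / (k : ℝ) * ((3 * k : ℝ) ^ 3 * S i) := by gcongr
            _ = 54 * (k : ℝ) ^ 2 * S i := by field_simp; ring
        calc (3 ^ i * y k) ^ 2 = (3 ^ i) ^ 2 * y k ^ 2 := by ring
          _ ≤ (3 ^ i) ^ 2 * (54 * (k : ℝ) ^ 2 * S i) := by gcongr
          _ = 54 * (3 ^ i * k : ℝ) ^ 2 * S i := by ring
          _ ≤ 54 * (m : ℝ) ^ 2 * S i := by
            have := hS0 i
            gcongr
    have h4 : (3 ^ i * y 1) ^ 2 ≤ 8 * 9 ^ t * V := by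
      calc (3 ^ i * y 1) ^ 2 = 9 ^ i * y 1 ^ 2 := by
            rw [mul_pow, ← pow_mul, mul_comm i 2, pow_mul]; norm_num
        _ ≤ 9 ^ t * (8 * V) := by
            have := (Finset.mem_range.1 hit).le
            gcongr
            norm_num
        _ = 8 * 9 ^ t * V := by ring
    linarith
  have h1 := Finset.sum_le_sum hi
  rw [Finset.sum_const, Finset.card_range, nsmul_eq_mul, Finset.sum_add_distrib, ← Finset.mul_sum,
    Finset.sum_const, Finset.card_range, nsmul_eq_mul] at h1
  have h2 : t * y m ^ 2 ≤ t * ((108 / t * (m : ℝ) ^ 2 + 16 * 9 ^ t) * V) := by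
    calc (t : ℝ) * y m ^ 2 ≤ 108 * (m : ℝ) ^ 2 * V + t * (16 * 9 ^ t * V) := by
          refine h1.trans ?_
          gcongr
      _ = _ := by field_simp
  exact le_of_mul_le_mul_left h2 ht0

/-- In the regime `(α, l + 1) = (2, 1)` or `α (l + 1) < 2`, the energy of the powers of exponent at
most `K r ^ (l + 1)` is at most `r ^ 2` at all large scales `r`, whatever `K` is. -/
theorem exists_forall_sq_le {α : ℝ} (hα : 0 < α) {l : ℕ}
    (h : α = 2 ∧ l = 0 ∨ α * (l + 1 : ℕ) < 2) (K : ℕ) :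
    ∃ r₀ : ℕ, ∀ r ≥ r₀, ∀ (y : ℕ → ℝ) (V : ℝ), (∀ m, 0 ≤ y m) →
      (∀ m j, y m ≤ y (m + j) + y j) → (∀ m j, y (m + j) ≤ y m + y j) → y 0 = 0 →
      (∀ A : Finset ℕ, ∑ j ∈ A, (1 + (j : ℝ)) ^ (-α - 1) * y j ^ 2 ≤ V) →
      ∀ m ≤ K * r ^ (l + 1), y m ^ 2 ≤ (r : ℝ) ^ 2 * V := by
  rcases h with ⟨rfl, rfl⟩ | h
  · set t := 216 * K ^ 2 + 1 with ht
    refine ⟨6 * 3 ^ t, fun r hr y V h0 hsub hadd hy0 hV m hm => ?_⟩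
    have hV0 : 0 ≤ V := by simpa using hV ∅
    refine (sq_le_div_mul_add h0 hsub hadd hy0 hV m t (by omega)).trans ?_
    refine mul_le_mul_of_nonneg_right ?_ hV0
    have hr' : 6 * 3 ^ t ≤ (r : ℝ) := by exact_mod_cast hr
    have h1 : 16 * 9 ^ t ≤ (r : ℝ) ^ 2 / 2 := by
      have h2 : (6 * 3 ^ t : ℝ) ^ 2 ≤ (r : ℝ) ^ 2 := pow_le_pow_left₀ (by positivity) hr' 2
      have h3 : (6 * 3 ^ t : ℝ) ^ 2 = 36 * 9 ^ t := by
        rw [mul_pow, ← pow_mul, mul_comm t 2, pow_mul]; norm_num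
      have h4 : (0 : ℝ) < 9 ^ t := by positivity
      linarith
    have h2 : 108 / (t : ℝ) * (m : ℝ) ^ 2 ≤ (r : ℝ) ^ 2 / 2 := by
      have hm' : (m : ℝ) ≤ K * r := by
        have : m ≤ K * r := by simpa using hm
        exact_mod_cast this
      have htt : (t : ℝ) = 216 * (K : ℝ) ^ 2 + 1 := by rw [ht]; push_cast; ring
      have ht0 : (0 : ℝ) < t := by rw [htt]; positivity
      rw [div_mul_eq_mul_div, div_le_iff₀ ht0]
      have h3 : (m : ℝ) ^ 2 ≤ (K * r) ^ 2 := pow_le_pow_left₀ (by positivity) hm' 2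
      rw [htt]
      nlinarith [sq_nonneg (r : ℝ)]
    linarith
  · have hp : 0 < 2 - α * (l + 1 : ℕ) := by linarith
    have hlim := (tendsto_rpow_atTop hp).comp (tendsto_natCast_atTop_atTop (R := ℝ))
    obtain ⟨r₀, hr₀⟩ := (hlim.eventually_ge_atTop
      (2 * 3 ^ (α + 1) * (K : ℝ) ^ α)).exists_forall_of_atTop
    refine ⟨max r₀ 1, fun r hr y V h0 hsub hadd hy0 hV m hm => ?_⟩
    have hV0 : 0 ≤ V := by simpa using hV ∅
    have hr1 : (0 : ℝ) < r := by
      have := le_of_max_le_right hr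
      exact_mod_cast this
    rcases Nat.eq_zero_or_pos m with rfl | hm0
    · rw [hy0, zero_pow two_ne_zero]; positivity
    · refine (sq_le_rpow_mul h0 hsub hα hV hm0).trans ?_
      refine mul_le_mul_of_nonneg_right ?_ hV0
      have h1 : (m : ℝ) ≤ K * (r : ℝ) ^ (l + 1) := by exact_mod_cast hm
      have h2 := hr₀ r (le_of_max_le_left hr)
      simp only [Function.comp] at h2
      calc 2 * 3 ^ (α + 1) * (m : ℝ) ^ α
          ≤ 2 * 3 ^ (α + 1) * (K * (r : ℝ) ^ (l + 1)) ^ α := by gcongr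
        _ = 2 * 3 ^ (α + 1) * (K : ℝ) ^ α * (r : ℝ) ^ (α * (l + 1 : ℕ)) := by
            rw [Real.mul_rpow (by positivity) (by positivity), ← Real.rpow_natCast (r : ℝ) (l + 1),
              ← Real.rpow_mul hr1.le, mul_comm ((l + 1 : ℕ) : ℝ) α]
            ring
        _ ≤ (r : ℝ) ^ (2 - α * (l + 1 : ℕ)) * (r : ℝ) ^ (α * (l + 1 : ℕ)) := by gcongr
        _ = (r : ℝ) ^ 2 := by
            rw [← Real.rpow_add hr1, sub_add_cancel]
            exact Real.rpow_two _

end PowerBounds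


/-! ### The measures `μ_{S,a}` -/

section StepMeasure

theorem powerWeight_nonneg (α : ℝ≥0∞) (m : ℤ) : 0 ≤ powerWeight α m := by
  unfold powerWeight
  split_ifs <;> positivity

theorem powerWeight_neg (α : ℝ≥0∞) (m : ℤ) : powerWeight α (-m) = powerWeight α m := by
  simp [powerWeight]

theorem powerWeight_pos_of_abs_le_one (α : ℝ≥0∞) {m : ℤ} (hm : |m| ≤ 1) :
    0 < powerWeight α m := by
  unfold powerWeight
  split_ifs <;> positivity

theorem summable_powerWeight {α : ℝ≥0∞} (hα : 0 < α) : Summable (powerWeight α) := by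
  by_cases h : α = ∞
  · refine summable_of_ne_finset_zero (s := Finset.Icc (-1) 1) fun m hm => ?_
    have : ¬ |m| ≤ 1 := fun h => hm (Finset.mem_Icc.2 (abs_le.1 h))
    simp [powerWeight, h, this]
  · have hα' : 0 < α.toReal := ENNReal.toReal_pos hα.ne' h
    have h1 := Real.summable_abs_int_rpow (b := α.toReal + 1) (by linarith)
    rw [← (Equiv.refl ℤ).summable_iff] at h1
    refine Summable.of_norm_bounded_eventually h1 ?_
    rw [Filter.eventually_cofinite]
    refine (Set.finite_singleton (0 : ℤ)).subset fun m hm => ?_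
    by_contra hm0
    refine hm ?_
    have hm1 : (0 : ℝ) < |(m : ℝ)| := abs_pos.2 (by exact_mod_cast hm0)
    rw [Real.norm_of_nonneg (powerWeight_nonneg α m), powerWeight, if_neg h]
    simp only [Function.comp, Equiv.refl_apply]
    rw [show -α.toReal - 1 = -(α.toReal + 1) by ring]
    exact Real.rpow_le_rpow_of_nonpos hm1 (by linarith) (by linarith)

theorem tsum_powerWeight_pos {α : ℝ≥0∞} (hα : 0 < α) : 0 < ∑' m : ℤ, powerWeight α m :=
  (summable_powerWeight hα).tsum_pos (powerWeight_nonneg α) 0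
    (powerWeight_pos_of_abs_le_one α (by simp))

theorem powerNorm_pos {α : ℝ≥0∞} (hα : 0 < α) : 0 < powerNorm α :=
  inv_pos.2 (tsum_powerWeight_pos hα)

variable {G : Type*} [Group G]

open Classical in
theorem summable_powerWeight_mul_ite {α : ℝ≥0∞} (hα : 0 < α) (s g : G) :
    Summable fun m : ℤ => powerWeight α m * (if s ^ m = g then 1 else 0) := by
  refine Summable.of_nonneg_of_le (fun m => ?_) (fun m => ?_) (summable_powerWeight hα)
  · have := powerWeight_nonneg α m
    split_ifs <;> simp [this]
  · have := powerWeight_nonneg α m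
    split_ifs <;> simp [this]

open Classical in
/-- The image of the weights under `m ↦ s ^ m` has the same total mass. -/
theorem hasSum_tsum_powerWeight {α : ℝ≥0∞} (hα : 0 < α) (s : G) :
    HasSum (fun g => ∑' m : ℤ, powerWeight α m * (if s ^ m = g then 1 else 0))
      (∑' m : ℤ, powerWeight α m) := by
  have hinj : Function.Injective fun m : ℤ => (s ^ m, m) := fun m n h => (Prod.mk.inj h).2
  have h1 : HasSum (fun p : G × ℤ => powerWeight α p.2 * (if s ^ p.2 = p.1 then 1 else 0))
      (∑' m : ℤ, powerWeight α m) := by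
    refine (hinj.hasSum_iff ?_).1 ?_
    · rintro ⟨g, m⟩ h
      have : s ^ m ≠ g := fun e => h ⟨m, by simp [e]⟩
      simp [this]
    · simpa [Function.comp_def] using (summable_powerWeight hα).hasSum
  exact h1.prod_fiberwise fun g => (summable_powerWeight_mul_ite hα s g).hasSum

variable {k : ℕ} {s : Fin k → G} {a : Fin k → ℝ≥0∞}

theorem isSymmProb_stepMeasure (hk : k ≠ 0) (ha : ∀ i, 0 < a i) :
    IsSymmProb (stepMeasure s a) where
  nonneg g := by
    refine mul_nonneg (by positivity) (Finset.sum_nonneg fun i _ =>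
      mul_nonneg (powerNorm_pos (ha i)).le (tsum_nonneg fun m => ?_))
    have := powerWeight_nonneg (a i) m
    split_ifs <;> simp [this]
  hasSum := by
    have h1 := (hasSum_sum (s := Finset.univ) fun i _ =>
      (hasSum_tsum_powerWeight (ha i) (s i)).mul_left (powerNorm (a i))).mul_left (1 / (k : ℝ))
    have h2 : 1 / (k : ℝ) * ∑ i, powerNorm (a i) * ∑' m : ℤ, powerWeight (a i) m = 1 := by
      have : ∀ i, powerNorm (a i) * ∑' m : ℤ, powerWeight (a i) m = 1 := fun i =>
        inv_mul_cancel₀ (tsum_powerWeight_pos (ha i)).ne'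
      have hk' : (k : ℝ) ≠ 0 := by exact_mod_cast hk
      simp [this, hk']
    rwa [h2] at h1
  symm g := by
    unfold stepMeasure
    congr 1
    refine Finset.sum_congr rfl fun i _ => ?_
    rw [← (Equiv.neg ℤ).tsum_eq]
    congr 1
    refine tsum_congr fun m => ?_
    have e : s i ^ (-m) = g⁻¹ ↔ s i ^ m = g := by simp
    rw [Equiv.neg_apply, powerWeight_neg]
    by_cases h : s i ^ m = g
    · rw [if_pos (e.2 h), if_pos h]
    · rw [if_neg fun h' => h (e.1 h'), if_neg h]

open Classical in
theorem le_stepMeasure (ha : ∀ i, 0 < a i) (i : Fin k) (m : ℤ) :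
    1 / (k : ℝ) * (powerNorm (a i) * powerWeight (a i) m) ≤ stepMeasure s a (s i ^ m) := by
  unfold stepMeasure
  refine mul_le_mul_of_nonneg_left ?_ (by positivity)
  have hnn : ∀ (i : Fin k) (m' : ℤ), 0 ≤
      powerWeight (a i) m' * (if s i ^ m' = s i ^ m then (1 : ℝ) else 0) := by
    intro i m'
    have := powerWeight_nonneg (a i) m'
    split_ifs <;> simp [this]
  refine le_trans ?_ (Finset.single_le_sum (f := fun j => powerNorm (a j) *
    ∑' m' : ℤ, powerWeight (a j) m' * (if s j ^ m' = s i ^ m then (1 : ℝ) else 0))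
    (fun j _ => mul_nonneg (powerNorm_pos (ha j)).le (tsum_nonneg fun m' => ?_))
    (Finset.mem_univ i))
  · refine mul_le_mul_of_nonneg_left ?_ (powerNorm_pos (ha i)).le
    refine le_trans (le_of_eq ?_)
      ((summable_powerWeight_mul_ite (ha i) (s i) (s i ^ m)).le_tsum m fun m' _ => hnn i m')
    simp
  · have := powerWeight_nonneg (a j) m'
    split_ifs <;> simp [this]

end StepMeasure

/-! ### Commutator length and the decay of the return probability -/

section Main

variable {G : Type*} [Group G]

/-- A finite commutator length is attained. -/
theorem exists_of_commLength_ne_top {g : G} (h : commLength g ≠ ⊤) :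
    ∃ l : ℕ, commLength g = ((l + 1 : ℕ) : ℕ∞) ∧
      (∃ m : ℤ, m ≠ 0 ∧ g ^ m ∈ Subgroup.lowerCentralSeries (⊤ : Subgroup G) l) ∧
      ∀ m : ℤ, m ≠ 0 → g ^ m ∉ Subgroup.lowerCentralSeries (⊤ : Subgroup G) (l + 1) := by
  set P : Set ℕ :=
    {j | ∃ m : ℤ, m ≠ 0 ∧ g ^ m ∈ Subgroup.lowerCentralSeries (⊤ : Subgroup G) j} with hP
  have hle : ∀ j ∈ P, ((j + 1 : ℕ) : ℕ∞) ≤ commLength g := fun j hj =>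
    le_iSup₂ (f := fun (j : ℕ) (_ : ∃ m : ℤ, m ≠ 0 ∧
      g ^ m ∈ Subgroup.lowerCentralSeries (⊤ : Subgroup G) j) => ((j + 1 : ℕ) : ℕ∞)) j hj
  obtain ⟨L, hL⟩ := ENat.ne_top_iff_exists.1 h
  have hbdd : BddAbove P := by
    refine ⟨L, fun j hj => ?_⟩
    have := hle j hj
    rw [← hL] at this
    have h2 : j + 1 ≤ L := by exact_mod_cast this
    omega
  have hne : P.Nonempty := ⟨0, 1, one_ne_zero, Subgroup.mem_top _⟩
  have hmem := Nat.sSup_mem hne hbdd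
  refine ⟨sSup P, le_antisymm (iSup₂_le fun j hj => ?_) (hle _ hmem), hmem, fun m hm hgm => ?_⟩
  · have : j ≤ sSup P := le_csSup hbdd hj
    exact_mod_cast Nat.succ_le_succ this
  · have : sSup P + 1 ≤ sSup P := le_csSup hbdd ⟨m, hm, hgm⟩
    omega

/-- The regime of the theorem, in terms of real exponents. -/
theorem exists_index_of_regime {g : G} {α : ℝ≥0∞} (hα : 0 < α)
    (h : (α = 2 ∧ commLength g = 1) ∨ α * (commLength g : ℝ≥0∞) < 2) :
    ∃ l : ℕ, (∃ m : ℤ, m ≠ 0 ∧ g ^ m ∈ Subgroup.lowerCentralSeries (⊤ : Subgroup G) l) ∧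
      (∀ m : ℤ, m ≠ 0 → g ^ m ∉ Subgroup.lowerCentralSeries (⊤ : Subgroup G) (l + 1)) ∧
      α ≠ ∞ ∧ (α.toReal = 2 ∧ l = 0 ∨ α.toReal * (l + 1 : ℕ) < 2) := by
  have htop : commLength g ≠ ⊤ := by
    intro e
    rcases h with ⟨-, h⟩ | h
    · rw [e] at h; exact absurd h (by simp)
    · rw [e, ENat.toENNReal_top, ENNReal.mul_top hα.ne'] at h
      exact absurd h (by simp)
  obtain ⟨l, hl, h1, h2⟩ := exists_of_commLength_ne_top htop
  refine ⟨l, h1, h2, ?_⟩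
  rw [hl] at h
  rcases h with ⟨rfl, h⟩ | h
  · have : l + 1 = 1 := by exact_mod_cast h
    exact ⟨by simp, Or.inl ⟨by simp, by omega⟩⟩
  · rw [ENat.toENNReal_coe] at h
    have hα' : α ≠ ∞ := by
      rintro rfl
      rw [ENNReal.top_mul (by simp)] at h
      exact absurd h (by simp)
    refine ⟨hα', Or.inr ?_⟩
    have h3 := (ENNReal.toReal_lt_toReal (ENNReal.mul_ne_top hα' (by simp)) (by simp)).2 h
    rw [ENNReal.toReal_mul, ENNReal.toReal_natCast] at h3
    simpa using h3

/-- The even return probabilities of `μ_{S,a}` are `o(n ^ (-D(G) / 2))`. -/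
theorem tendsto_sqrt_pow_mul_convPow_stepMeasure [Group.IsNilpotent G] {k : ℕ} (s : Fin k → G)
    (hs : Subgroup.closure (Set.range s) = ⊤) (a : Fin k → ℝ≥0∞) (ha : ∀ i, 0 < a i) {i : Fin k}
    {l : ℕ} (hl : ∃ m : ℤ, m ≠ 0 ∧ s i ^ m ∈ Subgroup.lowerCentralSeries (⊤ : Subgroup G) l)
    (hl' : ∀ m : ℤ, m ≠ 0 → s i ^ m ∉ Subgroup.lowerCentralSeries (⊤ : Subgroup G) (l + 1))
    (hi : a i ≠ ∞) (h : (a i).toReal = 2 ∧ l = 0 ∨ (a i).toReal * (l + 1 : ℕ) < 2) :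
    Tendsto (fun n : ℕ => √n ^ homogeneousDim G * convPow (stepMeasure s a) (2 * n) 1)
      atTop (𝓝 0) := by
  classical
  set μ := stepMeasure s a with hμdef
  have hk : k ≠ 0 := by rintro rfl; exact i.elim0
  have hk0 : (0 : ℝ) < k := by exact_mod_cast Nat.pos_of_ne_zero hk
  have hμ : IsSymmProb μ := isSymmProb_stepMeasure hk ha
  have hanti : ∀ n, convPow μ (2 * (n + 1)) 1 ≤ convPow μ (2 * n) 1 := fun n => by
    have := hμ.sum_le_sub n ∅
    simp only [Finset.sum_empty, mul_zero] at this
    linarith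
  -- A natural power of the special generator lies in the right term of the series.
  obtain ⟨q, hq, hsq⟩ : ∃ q : ℕ, q ≠ 0 ∧
      s i ^ q ∈ Subgroup.lowerCentralSeries (⊤ : Subgroup G) l := by
    obtain ⟨m, hm, hsm⟩ := hl
    refine ⟨m.natAbs, Int.natAbs_ne_zero.2 hm, ?_⟩
    rcases Int.natAbs_eq m with e | e
    · rw [e, zpow_natCast] at hsm; simpa using hsm
    · rw [e, zpow_neg, zpow_natCast] at hsm; simpa using inv_mem hsm
  set B : Set G := insert 1 (Set.range s ∪ (Set.range s)⁻¹) with hBdef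
  have hBf : B.Finite := ((Set.finite_range s).union (Set.finite_range s).inv).insert 1
  have hB : IsGenerating B := by
    refine ⟨Set.mem_insert _ _, ?_, ?_⟩
    · rintro x (rfl | hx | hx)
      · simp [hBdef]
      · exact Set.mem_insert_of_mem _ (Or.inr (by simpa using hx))
      · exact Set.mem_insert_of_mem _ (Or.inl hx)
    · rw [eq_top_iff, ← hs]
      exact Subgroup.closure_mono
        (Set.subset_union_left.trans (Set.subset_insert _ _))
  obtain ⟨C, hC⟩ := hB.exists_box_of_not_mem hBf hsq (fun m hm => by
    rw [← zpow_natCast, ← zpow_mul]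
    exact hl' _ (mul_ne_zero (by exact_mod_cast hq) hm))
  have hinj : Function.Injective fun m : ℕ => s i ^ m := by
    intro m n hmn
    by_contra hne
    refine hl' ((m : ℤ) - n) (sub_ne_zero.2 (by exact_mod_cast hne)) ?_
    simp only at hmn
    rw [zpow_sub, zpow_natCast, zpow_natCast, hmn, mul_inv_cancel]
    exact one_mem _
  -- The constants in the energy bounds for the generators.
  set w : Fin k → ℝ := fun j => 1 / (k : ℝ) * powerNorm (a j) with hw
  have hw0 : ∀ j, 0 < w j := fun j => mul_pos (by positivity) (powerNorm_pos (ha j))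
  have hμ1 : 0 < μ 1 := by
    have h1 := le_stepMeasure (s := s) ha i 0
    rw [zpow_zero, ← mul_assoc] at h1
    exact lt_of_lt_of_le (mul_pos (hw0 i) (powerWeight_pos_of_abs_le_one _ (by simp))) h1
  have hμs : ∀ j, 0 < μ (s j) := fun j => by
    have h1 := le_stepMeasure (s := s) ha j 1
    rw [zpow_one, ← mul_assoc] at h1
    exact lt_of_lt_of_le (mul_pos (hw0 j) (powerWeight_pos_of_abs_le_one _ (by simp))) h1
  set c₁ : ℝ := 2 / (μ 1 * w i) + ∑ j, 2 / (μ 1 * μ (s j)) with hc₁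
  have hc₁0 : 0 ≤ c₁ := by
    have h1 : 0 < μ 1 * w i := mul_pos hμ1 (hw0 i)
    have h2 : ∀ j, 0 < μ 1 * μ (s j) := fun j => mul_pos hμ1 (hμs j)
    have h3 : ∀ j, 0 ≤ 2 / (μ 1 * μ (s j)) := fun j => (div_pos two_pos (h2 j)).le
    have h4 := Finset.sum_nonneg fun j (_ : j ∈ Finset.univ) => h3 j
    have h5 := (div_pos two_pos h1).le
    linarith
  refine tendsto_sqrt_pow_mul_of_nash (fun n => hμ.convPow_nonneg _ _)
    (antitone_nat_of_succ_le hanti) (homogeneousDim G) (C := C ^ 2 * c₁ / 2 + 1)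
    (by have : 0 ≤ (C : ℝ) ^ 2 * c₁ / 2 := by positivity
        linarith) ?_
  intro K hK
  obtain ⟨r₀, hr₀⟩ := exists_forall_sq_le (ENNReal.toReal_pos (ha i).ne' hi) h (q * K)
  refine ⟨max r₀ 1, fun r hr n => ?_⟩
  have hr1 : 1 ≤ r := le_of_max_le_right hr
  obtain ⟨N, hN0, hN1, hN, hNinv, hNsq⟩ := hμ.exists_translation_dist n
  set E := convPow μ (2 * n) 1 - convPow μ (2 * (n + 1)) 1 with hE
  have hE0 : 0 ≤ E := sub_nonneg.2 (hanti n)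
  have hdir : ∀ A : Finset G, μ 1 * ∑ x ∈ A, μ x * N x ^ 2 ≤ 2 * E := by
    intro A
    have h1 := hμ.sum_le_sub n A
    simp_rw [hNsq]
    calc _ = 2 * (μ 1 * ∑ x ∈ A, μ x * (convPow μ (2 * n) 1 - convPow μ (2 * n) x)) := by
          simp_rw [Finset.mul_sum]
          refine Finset.sum_congr rfl fun x _ => ?_
          ring
      _ ≤ 2 * E := by linarith
  set V := c₁ * E with hV
  have hV0 : 0 ≤ V := mul_nonneg hc₁0 hE0
  have hNs : ∀ j, N (s j) ≤ √V := by
    intro j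
    apply Real.le_sqrt_of_sq_le
    have h1 := hdir {s j}
    rw [Finset.sum_singleton, ← mul_assoc] at h1
    have h2 : 0 < μ 1 * μ (s j) := mul_pos hμ1 (hμs j)
    have h3 : N (s j) ^ 2 ≤ 2 / (μ 1 * μ (s j)) * E := by
      rw [div_mul_eq_mul_div, le_div_iff₀ h2]; linarith
    have h4 : 2 / (μ 1 * μ (s j)) ≤ ∑ j, 2 / (μ 1 * μ (s j)) :=
      Finset.single_le_sum (f := fun j => 2 / (μ 1 * μ (s j)))
        (fun j _ => (div_pos two_pos (mul_pos hμ1 (hμs j))).le) (Finset.mem_univ j)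
    have h5 : 0 < 2 / (μ 1 * w i) := div_pos two_pos (mul_pos hμ1 (hw0 i))
    refine h3.trans (mul_le_mul_of_nonneg_right ?_ hE0)
    linarith
  have hNB : ∀ x ∈ B, N x ≤ √V := by
    rintro x (rfl | ⟨j, rfl⟩ | hx)
    · rw [hN1]; positivity
    · exact hNs j
    · obtain ⟨j, hj⟩ := hx
      rw [← hNinv, ← hj]
      exact hNs j
  have hpow := hr₀ r (le_of_max_le_left hr) (fun m => N (s i ^ m)) V (fun m => hN0 _)
    (fun m j => by
      have h1 := hN (s i ^ (m + j)) (s i ^ j)⁻¹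
      rw [hNinv, pow_add, mul_inv_cancel_right] at h1
      simpa only [pow_add] using h1)
    (fun m j => by simpa only [pow_add] using hN (s i ^ m) (s i ^ j)) (by simpa using hN1)
    (fun A => by
      have h1 := hdir (A.image fun m : ℕ => s i ^ m)
      rw [Finset.sum_image fun x _ y _ e => hinj e] at h1
      have h2 : w i * ∑ j ∈ A, (1 + (j : ℝ)) ^ (-(a i).toReal - 1) * N (s i ^ j) ^ 2 ≤
          ∑ j ∈ A, μ (s i ^ j) * N (s i ^ j) ^ 2 := by
        rw [Finset.mul_sum]
        refine Finset.sum_le_sum fun j _ => ?_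
        rw [← mul_assoc]
        refine mul_le_mul_of_nonneg_right ?_ (sq_nonneg _)
        have h3 := le_stepMeasure (s := s) ha i (j : ℤ)
        rw [zpow_natCast, ← mul_assoc, powerWeight, if_neg hi] at h3
        simpa [hw, hμdef] using h3
      have h4 : 0 < μ 1 * w i := mul_pos hμ1 (hw0 i)
      have h5 : μ 1 * w i * ∑ j ∈ A, (1 + (j : ℝ)) ^ (-(a i).toReal - 1) * N (s i ^ j) ^ 2 ≤
          2 * E := by
        rw [mul_assoc]
        exact (mul_le_mul_of_nonneg_left h2 hμ1.le).trans h1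
      have h6 : ∑ j ∈ A, (1 + (j : ℝ)) ^ (-(a i).toReal - 1) * N (s i ^ j) ^ 2 ≤
          2 / (μ 1 * w i) * E := by
        rw [div_mul_eq_mul_div, le_div_iff₀ h4]; linarith
      refine h6.trans (mul_le_mul_of_nonneg_right ?_ hE0)
      have h7 := Finset.sum_nonneg fun j (_ : j ∈ Finset.univ) =>
        (div_pos two_pos (mul_pos hμ1 (hμs j))).le
      linarith)
  obtain ⟨Q, hQc, hQ⟩ := hC r hr1 K N hN1.le hN (√V) (Real.sqrt_nonneg _) hNB (fun m hm => by
    rw [← pow_mul]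
    have h1 := hpow (q * m) (by rw [mul_assoc]; exact Nat.mul_le_mul_left q hm)
    rw [← Real.sqrt_sq (hN0 (s i ^ (q * m)))]
    refine (Real.sqrt_le_sqrt h1).trans (le_of_eq ?_)
    rw [Real.sqrt_mul (by positivity), Real.sqrt_sq (by positivity)])
  have hr0 : (0 : ℝ) < r := by exact_mod_cast hr1
  have hK0 : (0 : ℝ) < K := by exact_mod_cast hK
  have hQne : Q.Nonempty := by
    rw [← Finset.card_pos]
    exact lt_of_lt_of_le (by positivity) hQc
  refine (hμ.convPow_le_of_finset n (b := (C ^ 2 * c₁ / 2 + 1) * (r : ℝ) ^ 2 * E) hQne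
    fun x hx => ?_).trans ?_
  · have h1 := pow_le_pow_left₀ (hN0 x) (hQ x hx) 2
    rw [hNsq, mul_pow, mul_pow, Real.sq_sqrt hV0] at h1
    have h2 : 0 ≤ (r : ℝ) ^ 2 * E := by positivity
    rw [hV] at h1
    nlinarith
  · gcongr
    exact_mod_cast hQc

end Main

end NilpotentWalk

open NilpotentWalk in
theorem mainTheorem2 {G : Type*} [Group G] [Group.IsNilpotent G]
    {k : ℕ} (s : Fin k → G) (hs : Subgroup.closure (Set.range s) = ⊤)
    (a : Fin k → ℝ≥0∞) (ha : ∀ i, 0 < a i)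
    (h : ∃ i, (a i = 2 ∧ NilpotentWalk.commLength (s i) = 1) ∨
      a i * (NilpotentWalk.commLength (s i) : ℝ≥0∞) < 2) :
    Tendsto (fun n : ℕ => (n : ℝ) ^ ((NilpotentWalk.homogeneousDim G : ℝ) / 2) *
      NilpotentWalk.convPow (NilpotentWalk.stepMeasure s a) n 1) atTop (𝓝 0) ∧
    ∀ A : Finset G, (∀ x ∈ A, x⁻¹ ∈ A) → Subgroup.closure (A : Set G) = ⊤ →
      (fun n : ℕ => NilpotentWalk.convPow (NilpotentWalk.stepMeasure s a) (2 * n) 1) =o[atTop]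
        (fun n : ℕ => NilpotentWalk.convPow (NilpotentWalk.uniformMeasure A) (2 * n) 1) := by
  obtain ⟨i, hi⟩ := h
  obtain ⟨l, hl, hl', hai, hreg⟩ := exists_index_of_regime (ha i) hi
  have heven := tendsto_sqrt_pow_mul_convPow_stepMeasure s hs a ha hl hl' hai hreg
  have hk : k ≠ 0 := by rintro rfl; exact i.elim0
  have hμ : IsSymmProb (stepMeasure s a) := isSymmProb_stepMeasure hk ha
  refine ⟨?_, fun A hA hgen => ?_⟩
  · have hhalf : Tendsto (fun n : ℕ => n / 2) atTop atTop :=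
      Nat.tendsto_div_const_atTop two_ne_zero
    have hlim := (heven.comp hhalf).const_mul (√3 ^ homogeneousDim G)
    rw [mul_zero] at hlim
    refine tendsto_of_tendsto_of_tendsto_of_le_of_le' tendsto_const_nhds hlim
      (Eventually.of_forall fun n => mul_nonneg (by positivity) (hμ.convPow_nonneg _ _)) ?_
    filter_upwards [eventually_ge_atTop 2] with n hn
    simp only [Function.comp]
    have h1 : (n : ℝ) ^ ((homogeneousDim G : ℝ) / 2) = √n ^ homogeneousDim G := by
      rw [Real.sqrt_eq_rpow, ← Real.rpow_natCast, ← Real.rpow_mul (Nat.cast_nonneg n)]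
      congr 1; ring
    have h2 : convPow (stepMeasure s a) n 1 ≤ convPow (stepMeasure s a) (2 * (n / 2)) 1 := by
      rcases Nat.mod_two_eq_zero_or_one n with h | h
      · rw [show 2 * (n / 2) = n by omega]
      · conv_lhs => rw [show n = 2 * (n / 2) + 1 by omega]
        exact hμ.convPow_two_mul_add_one_le _
    have h3 : √(n : ℝ) ≤ √3 * √((n / 2 : ℕ) : ℝ) := by
      rw [← Real.sqrt_mul (by norm_num)]
      apply Real.sqrt_le_sqrt
      have : n ≤ 3 * (n / 2) := by omega
      exact_mod_cast this
    rw [h1, ← mul_assoc, ← mul_pow]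
    exact mul_le_mul (pow_le_pow_left₀ (by positivity) h3 _) h2 (hμ.convPow_nonneg _ _)
      (by positivity)
  · have hne : A.Nonempty := by
      rw [Finset.nonempty_iff_ne_empty]
      rintro rfl
      rw [Finset.coe_empty, Subgroup.closure_empty] at hgen
      have h1 : s i ∈ (⊥ : Subgroup G) := hgen ▸ Subgroup.mem_top _
      rw [Subgroup.mem_bot] at h1
      exact hl' 1 one_ne_zero (by rw [h1, one_zpow]; exact one_mem _)
    obtain ⟨c, hc, hlow⟩ := exists_pos_le_convPow_uniformMeasure hA hne hgen
    rw [isLittleO_iff]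
    intro ε hε
    filter_upwards [heven.eventually_lt_const (show 0 < ε * c by positivity),
      eventually_ge_atTop 1] with n hn hn1
    have hn0 : (0 : ℝ) < √n ^ homogeneousDim G := by
      have : (0 : ℝ) < n := by exact_mod_cast hn1
      positivity
    rw [Real.norm_of_nonneg (hμ.convPow_nonneg _ _),
      Real.norm_of_nonneg ((isSymmProb_uniformMeasure hA hne).convPow_nonneg _ _)]
    refine le_of_mul_le_mul_left (hn.le.trans ?_) hn0
    calc ε * c ≤ ε * (√n ^ homogeneousDim G * convPow (uniformMeasure A) (2 * n) 1) := by
          gcongr; exact hlow n hn1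
      _ = _ := by ring
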